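/- For $d\ge 1$ let $\mathbf{C}[x]_d$ be the space of ternary forms $f=\sum_u f_u x^u$ of degree $d$ in $x=(x_0,x_1,x_2)$ (including $0$), where $u$ runs over the set $E_d$ of exponents $u\in\mathbf{Z}_{\ge0}^3$ with $u_0+u_1+u_2=d$, and let $n_d=\binom{d+2}{2}=\#E_d$. Write $\partial_i=\partial/\partial x_i$. A polynomial in $n_d$ variables indexed by $E_d$ is evaluated at a form $f$ by substituting the coefficients $f_u$; similarly a polynomial in $3n_d$ variables is evaluated at a triple of forms. For $d\ge 2$ the discriminant $\Delta_d$ is the polynomial with integer coefficients in $n_d$ variables determined by: (a) for all $f\in\mathbf{C}[x]_d$, $\Delta_d(f)=0$ if and only if $f,\partial_0f,\partial_1f,\partial_2f$ have a common zero $z\neq(0,0,0)$ in $\mathbf{C}^3$; (b) $\Delta_d$ is irreducible over $\mathbf{Z}$ and has content $1$; (c) $\Delta_d(x_0^d+x_1^d+x_2^d)<0$. For $d\ge 1$ the resultant $R_d$ is the polynomial with integer coefficients in $3n_d$ variables determined by: (a) for all $f_0,f_1,f_2\in\mathbf{C}[x]_d$, $R_d(f_0,f_1,f_2)=0$ if and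 only if $f_0,f_1,f_2$ have a common zero $z\neq(0,0,0)$ in $\mathbf{C}^3$; (b) $R_d$ is irreducible over $\mathbf{Z}$ and has content $1$; (c) $R_d(x_0^d,x_1^d,x_2^d)=1$. Proposition. Let $d\ge 2$. There is exactly one polynomial $\Delta_d$ and exactly one polynomial $R_{d-1}$ with these properties, and for all $f\in\mathbf{C}[x]_d$ $$\Delta_d(f) = -d^{-d^2+3d-3}\,R_{d-1}(\partial_0 f,\partial_1 f,\partial_2 f).$$ -/

import Mathlib

namespace TernaryForm

open MvPolynomial

/-- Exponents of the monomials of degree `d` in `x₀, x₁, x₂`. -/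
abbrev Exponents (d : ℕ) : Type := {u : Fin 3 →₀ ℕ // u.degree = d}

/-- The vector of degree `d` coefficients of `f`. -/
def coeffs {A : Type*} [CommRing A] (d : ℕ) (f : MvPolynomial (Fin 3) A) : Exponents d → A :=
  fun u => f.coeff u.1

/-- Value at a ternary form `f` of degree `d` of an integer polynomial in the coefficients. -/
noncomputable def evalAt {A : Type*} [CommRing A] {d : ℕ} (P : MvPolynomial (Exponents d) ℤ)
    (f : MvPolynomial (Fin 3) A) : A :=
  aeval (coeffs d f) P

/-- Value at a triple of ternary forms of degree `d` of an integer polynomial in the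
`3 * (d + 2).choose 2` coefficients; the variable `(i, u)` is the coefficient of `x ^ u` in the
form `f i`. -/
noncomputable def evalAtTriple {A : Type*} [CommRing A] {d : ℕ}
    (P : MvPolynomial (Fin 3 × Exponents d) ℤ) (f : Fin 3 → MvPolynomial (Fin 3) A) : A :=
  aeval (fun p : Fin 3 × Exponents d => coeffs d (f p.1) p.2) P

/-- The greatest common divisor of the coefficients is `1`. -/
def HasContentOne {σ : Type*} (P : MvPolynomial σ ℤ) : Prop :=
  P.support.gcd (fun m => P.coeff m) = 1

/-- `f` and its three partial derivatives have a common zero other than the origin. -/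
def IsSingular (f : MvPolynomial (Fin 3) ℂ) : Prop :=
  ∃ z : Fin 3 → ℂ, z ≠ 0 ∧ eval z f = 0 ∧ ∀ i, eval z (pderiv i f) = 0

/-- `f 0, f 1, f 2` have a common zero other than the origin. -/
def HaveCommonRoot (f : Fin 3 → MvPolynomial (Fin 3) ℂ) : Prop :=
  ∃ z : Fin 3 → ℂ, z ≠ 0 ∧ ∀ i, eval z (f i) = 0

/-- The properties that determine the discriminant `Δ_d` of ternary forms of degree `d`. -/
structure IsDiscriminant (d : ℕ) (Δ : MvPolynomial (Exponents d) ℤ) : Prop where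
  eval_eq_zero_iff : ∀ f : MvPolynomial (Fin 3) ℂ, f.IsHomogeneous d →
    (evalAt Δ f = 0 ↔ IsSingular f)
  irreducible : Irreducible Δ
  content : HasContentOne Δ
  neg : evalAt Δ (X 0 ^ d + X 1 ^ d + X 2 ^ d : MvPolynomial (Fin 3) ℤ) < 0

/-- The properties that determine the resultant `R_d` of three ternary forms of degree `d`. -/
structure IsResultant (d : ℕ) (R : MvPolynomial (Fin 3 × Exponents d) ℤ) : Prop where
  eval_eq_zero_iff : ∀ f : Fin 3 → MvPolynomial (Fin 3) ℂ, (∀ i, (f i).IsHomogeneous d) →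
    (evalAtTriple R f = 0 ↔ HaveCommonRoot f)
  irreducible : Irreducible R
  content : HasContentOne R
  normalized : evalAtTriple R (fun i => (X i ^ d : MvPolynomial (Fin 3) ℤ)) = 1

end TernaryForm

namespace TernaryForm

open MvPolynomial

/-! ### Forms and their coefficients -/

/-! The resultant is constructed for three forms of arbitrary positive degrees. The integer
polynomials vanishing on the generic triple with a common zero form a prime ideal. Two plane curves
always meet, so this ideal contains no nonzero polynomial free of the coefficient of `x₀ ^ d₀` in
the first form; over a factorial ring that makes it principal (`exists_prime_span_singleton`). It
contains Macaulay's determinants. One of them equals 1 at the powers of the variables, which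
normalizes the generator; together they show that over any algebraically closed field, of any
characteristic, the resultant vanishes only if there is a common zero (`res_eq_zero_iff`). From the
zeros follow homogeneity in each form (`res_scaleAt`), invariance under adding multiples of the
other forms (`res_update_add`) and multiplicativity (`res_update_mul`).

For a form `f` of degree `n`, Euler's identity gives `Res(x₀, ∂₁f, ∂₂f) Res(∂₀f, ∂₁f, ∂₂f) = n ^
(n-1)² Res(f, ∂₁f, ∂₂f)`, and, with `c` the coefficient of `x₂ ^ n`, `n c Res(x₀, ∂₁f, ∂₂f) = n ^
(n-1) Res(x₀, f, ∂₂f)`. The resultants on the right are primitive as polynomials in the coefficients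
of `f`, since modulo each prime some form makes them nonzero. By Gauss's lemma `Res(∂₀f, ∂₁f, ∂₂f)`
is `n ^ ((n-1)² - (n-2))` times a primitive `P`, and this exponent is `n² - 3n + 3`.

It remains to see that `P` is irreducible (`prime_of_polarRes_eq`). Singular forms are parametrized
by an affine space, so the ideal of polynomials vanishing on them is prime. A prime factor `Q` of
`P` in this ideal has the same zeros as `P`, hence `P = ±Q ^ k` by the Nullstellensatz. On a
suitable pencil `P` is not identically zero and has a root, and all its roots are simple; so `k =
1`. Since `P` is positive at the Fermat form, the discriminant is `-P`. Uniqueness holds because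
irreducible integer polynomials with the same nonempty complex zero set agree up to sign. -/

instance (n : ℕ) : Finite (Exponents n) := by
  refine Set.Finite.to_subtype (s := {u : Fin 3 →₀ ℕ | u.degree = n})
    (((Finset.finsuppAntidiag Finset.univ n).finite_toSet).subset fun u hu => ?_)
  simpa [Finset.mem_finsuppAntidiag, Finsupp.degree_eq_sum] using hu

noncomputable instance (n : ℕ) : Fintype (Exponents n) := Fintype.ofFinite _

variable {S T : Type*} [CommRing S] [CommRing T]

/-- The form of degree `n` with given coefficients. -/
noncomputable def ofCoeffs {n : ℕ} (c : Exponents n → S) : MvPolynomial (Fin 3) S :=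
  ∑ u, monomial u.1 (c u)

theorem coeff_ofCoeffs {n : ℕ} (c : Exponents n → S) (u : Exponents n) :
    (ofCoeffs c).coeff u.1 = c u := by
  classical
  simp [ofCoeffs, coeff_sum, coeff_monomial, Subtype.ext_iff.symm]

theorem isHomogeneous_ofCoeffs {n : ℕ} (c : Exponents n → S) : (ofCoeffs c).IsHomogeneous n :=
  IsHomogeneous.sum _ _ _ fun u _ => isHomogeneous_monomial _ u.2

theorem ext_of_isHomogeneous {n : ℕ} {f g : MvPolynomial (Fin 3) S} (hf : f.IsHomogeneous n)
    (hg : g.IsHomogeneous n) (h : ∀ u : Exponents n, f.coeff u.1 = g.coeff u.1) : f = g := by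
  ext u
  by_cases hu : u.degree = n
  · exact h ⟨u, hu⟩
  · rw [hf.coeff_eq_zero hu, hg.coeff_eq_zero hu]

theorem ofCoeffs_coeff {n : ℕ} {f : MvPolynomial (Fin 3) S} (hf : f.IsHomogeneous n) :
    ofCoeffs (fun u : Exponents n => f.coeff u.1) = f :=
  ext_of_isHomogeneous (isHomogeneous_ofCoeffs _) hf fun u => coeff_ofCoeffs _ u

theorem map_ofCoeffs (φ : S →+* T) {n : ℕ} (c : Exponents n → S) :
    map φ (ofCoeffs c) = ofCoeffs fun u => φ (c u) := by
  simp [ofCoeffs]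

theorem map_eval_point (φ : S →+* T) (z : Fin 3 → S) (f : MvPolynomial (Fin 3) S) :
    φ (eval z f) = eval (fun i => φ (z i)) (map φ f) := by
  rw [eval_map, ← eval₂_id, eval₂_comp_left, RingHom.comp_id]
  rfl

/-! ### Substitution into integer polynomials, and generic triples of forms. -/

/-- The coefficients of a triple of forms of degrees `d 0, d 1, d 2`. -/
abbrev CoeffIndex (d : Fin 3 → ℕ) : Type := Σ i, Exponents (d i)

/-- Substitution into polynomials with integer coefficients. -/
noncomputable def subst {σ : Type*} (c : σ → S) : MvPolynomial σ ℤ →+* S :=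
  eval₂Hom (Int.castRingHom S) c

@[simp]
theorem subst_X {σ : Type*} (c : σ → S) (v : σ) : subst c (X v) = c v := by
  simp [subst]

theorem aeval_eq_subst {σ : Type*} (c : σ → S) (P : MvPolynomial σ ℤ) :
    aeval c P = subst c P := rfl

theorem map_subst {σ : Type*} (φ : S →+* T) (c : σ → S) (P : MvPolynomial σ ℤ) :
    φ (subst c P) = subst (fun v => φ (c v)) P := by
  rw [subst, map_eval₂Hom]
  congr 2
  exact RingHom.ext_int _ _

theorem subst_X_left {σ : Type*} (P : MvPolynomial σ ℤ) : subst X P = P := by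
  have : subst (X : σ → MvPolynomial σ ℤ) = RingHom.id _ := by
    ext <;> simp
  rw [this, RingHom.id_apply]

theorem subst_rename {σ τ : Type*} (ι : σ → τ) (c : τ → S) (P : MvPolynomial σ ℤ) :
    subst c (rename ι P) = subst (fun v => c (ι v)) P := by
  simp [subst, eval₂_rename, Function.comp_def]

/-- Value of an integer polynomial in the coefficients at a triple of forms of degrees
`d 0, d 1, d 2`. -/
noncomputable def evalForms {d : Fin 3 → ℕ} (P : MvPolynomial (CoeffIndex d) ℤ)
    (f : Fin 3 → MvPolynomial (Fin 3) S) : S :=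
  subst (fun v : CoeffIndex d => (f v.1).coeff v.2.1) P

/-- The triple of generic forms of degrees `d 0, d 1, d 2`. -/
noncomputable def genericForms (d : Fin 3 → ℕ) (i : Fin 3) :
    MvPolynomial (Fin 3) (MvPolynomial (CoeffIndex d) ℤ) :=
  ofCoeffs fun u => X ⟨i, u⟩

theorem isHomogeneous_genericForms (d : Fin 3 → ℕ) (i : Fin 3) :
    (genericForms d i).IsHomogeneous (d i) := isHomogeneous_ofCoeffs _

variable {d : Fin 3 → ℕ}

theorem map_evalForms (φ : S →+* T) (P : MvPolynomial (CoeffIndex d) ℤ)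
    (f : Fin 3 → MvPolynomial (Fin 3) S) :
    φ (evalForms P f) = evalForms P fun i => map φ (f i) := by
  simp only [evalForms, map_subst, coeff_map]

theorem evalForms_genericForms (P : MvPolynomial (CoeffIndex d) ℤ) :
    evalForms P (genericForms d) = P := by
  have : (fun v : CoeffIndex d => (genericForms d v.1).coeff v.2.1) = X := by
    funext v
    exact coeff_ofCoeffs _ v.2
  rw [evalForms, this, subst_X_left]

@[simp]
theorem evalForms_mul (P Q : MvPolynomial (CoeffIndex d) ℤ)
    (f : Fin 3 → MvPolynomial (Fin 3) S) :
    evalForms (P * Q) f = evalForms P f * evalForms Q f := map_mul _ _ _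

@[simp]
theorem evalForms_zero (f : Fin 3 → MvPolynomial (Fin 3) S) :
    evalForms (0 : MvPolynomial (CoeffIndex d) ℤ) f = 0 := map_zero _

theorem map_subst_genericForms {f : Fin 3 → MvPolynomial (Fin 3) S}
    (hf : ∀ i, (f i).IsHomogeneous (d i)) (i : Fin 3) :
    map (subst fun v : CoeffIndex d => (f v.1).coeff v.2.1) (genericForms d i) = f i := by
  rw [genericForms, map_ofCoeffs]
  simpa using ofCoeffs_coeff (hf i)

/-- The forms have a common zero other than the origin. -/
def HasCommonZero (f : Fin 3 → MvPolynomial (Fin 3) S) : Prop :=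
  ∃ z : Fin 3 → S, z ≠ 0 ∧ ∀ i, eval z (f i) = 0

/-! ### Macaulay determinants -/

/-- The matrix of coefficients in degree `N` of the polynomials `x ^ (g u).2 * f (g u).1`. -/
noncomputable def macaulayMatrix {N : ℕ} (g : Exponents N → Fin 3 × (Fin 3 →₀ ℕ))
    (f : Fin 3 → MvPolynomial (Fin 3) S) : Matrix (Exponents N) (Exponents N) S :=
  .of fun u w => (monomial (g w).2 1 * f (g w).1).coeff u.1

open scoped Classical in
/-- The determinant of the Macaulay matrix of the generic forms. -/
noncomputable def macaulayDet (d : Fin 3 → ℕ) {N : ℕ} (g : Exponents N → Fin 3 × (Fin 3 →₀ ℕ)) :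
    MvPolynomial (CoeffIndex d) ℤ :=
  (macaulayMatrix g (genericForms d)).det

open scoped Classical in
theorem map_det_macaulayMatrix (φ : S →+* T) {N : ℕ} (g : Exponents N → Fin 3 × (Fin 3 →₀ ℕ))
    (f : Fin 3 → MvPolynomial (Fin 3) S) :
    φ (macaulayMatrix g f).det = (macaulayMatrix g fun i => map φ (f i)).det := by
  rw [RingHom.map_det]
  congr 1
  ext u w
  simp [macaulayMatrix, ← coeff_map]

open scoped Classical in
theorem evalForms_macaulayDet {N : ℕ} (g : Exponents N → Fin 3 × (Fin 3 →₀ ℕ))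
    {f : Fin 3 → MvPolynomial (Fin 3) S} (hf : ∀ i, (f i).IsHomogeneous (d i)) :
    evalForms (macaulayDet d g) f = (macaulayMatrix g f).det := by
  have h := map_det_macaulayMatrix (subst fun v : CoeffIndex d => (f v.1).coeff v.2.1) g (genericForms d)
  simp only [map_subst_genericForms hf] at h
  exact h

theorem eval_eq_sum_exponents {n : ℕ} {f : MvPolynomial (Fin 3) S} (hf : f.IsHomogeneous n)
    (z : Fin 3 → S) : eval z f = ∑ u : Exponents n, (∏ i, z i ^ u.1 i) * f.coeff u.1 := by
  conv_lhs => rw [← ofCoeffs_coeff hf]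
  simp [ofCoeffs, eval_monomial, Finsupp.prod_fintype, mul_comm]

-- The vector of all monomials of degree `N` evaluated at a common zero `z` is in the left kernel.
-- It is nonzero because it contains the power `z j ^ N` of a nonzero coordinate.
open scoped Classical in
theorem det_macaulayMatrix_eq_zero [IsDomain S] {N : ℕ}
    {g : Exponents N → Fin 3 × (Fin 3 →₀ ℕ)} (hg : ∀ u, (g u).2.degree + d (g u).1 = N)
    {f : Fin 3 → MvPolynomial (Fin 3) S} (hf : ∀ i, (f i).IsHomogeneous (d i))
    (h : HasCommonZero f) : (macaulayMatrix g f).det = 0 := by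
  obtain ⟨z, hz, hzf⟩ := h
  obtain ⟨j, hj⟩ := Function.ne_iff.mp hz
  rw [← Matrix.exists_vecMul_eq_zero_iff]
  refine ⟨fun u => ∏ i, z i ^ u.1 i, Function.ne_iff.mpr ⟨⟨Finsupp.single j N, by simp⟩, ?_⟩, ?_⟩
  · rw [Finset.prod_eq_single j]
    · simpa using pow_ne_zero _ hj
    · intro i _ hi
      simp [hi.symm]
    · simp
  · funext w
    have hh : (monomial (g w).2 (1 : S) * f (g w).1).IsHomogeneous N := by
      have := (isHomogeneous_monomial (R := S) 1 (rfl : (g w).2.degree = _)).mul (hf (g w).1)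
      rwa [hg w] at this
    have := eval_eq_sum_exponents hh z
    simp only [map_mul, hzf, mul_zero] at this
    simpa [Matrix.vecMul, dotProduct, macaulayMatrix] using this.symm

/-- A monomial of large degree lies in an ideal containing powers of all variables. -/
theorem monomial_mem_of_X_pow_mem {I : Ideal (MvPolynomial (Fin 3) S)} {n : ℕ}
    (h : ∀ i, (X i : MvPolynomial (Fin 3) S) ^ n ∈ I) {u : Fin 3 →₀ ℕ} (hu : 3 * n ≤ u.degree) :
    monomial u 1 ∈ I := by
  obtain ⟨i, hi⟩ : ∃ i, n ≤ u i := by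
    by_contra! hlt
    have h0 := hlt 0
    have h1 := hlt 1
    have h2 := hlt 2
    rw [Finsupp.degree_eq_sum, Fin.sum_univ_three] at hu
    omega
  have : monomial u (1 : S) = monomial (u - Finsupp.single i n) 1 * X i ^ n := by
    rw [X_pow_eq_monomial, monomial_mul, one_mul, tsub_add_cancel_of_le (by simpa using hi)]
  rw [this]
  exact I.mul_mem_left _ (h i)

-- By the Nullstellensatz the ideal of the forms contains powers of all variables, hence all
-- monomials of some degree `N`. So the products of degree `N` of a monomial with one of the forms
-- span all forms of degree `N`, and a basis chosen among them gives an invertible matrix.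
open scoped Classical in
theorem exists_det_macaulayMatrix_ne_zero {K : Type*} [Field K] [IsAlgClosed K]
    {f : Fin 3 → MvPolynomial (Fin 3) K} (hf : ∀ i, (f i).IsHomogeneous (d i))
    (h : ¬ HasCommonZero f) :
    ∃ (N : ℕ) (g : Exponents N → Fin 3 × (Fin 3 →₀ ℕ)),
      (∀ u, (g u).2.degree + d (g u).1 = N) ∧ (macaulayMatrix g f).det ≠ 0 := by
  set I := Ideal.span (Set.range f) with hI
  have hX : ∀ i, (X i : MvPolynomial (Fin 3) K) ∈ I.radical := by
    intro i
    rw [← vanishingIdeal_zeroLocus_eq_radical (K := K), mem_vanishingIdeal_iff]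
    intro z hz
    rw [hI, zeroLocus_span] at hz
    have : z = 0 := by
      by_contra hne
      exact h ⟨z, hne, fun i => by simpa [aeval_eq_eval] using hz (f i) ⟨i, rfl⟩⟩
    simp [this]
  obtain ⟨n, hn⟩ : ∃ n, ∀ i, (X i : MvPolynomial (Fin 3) K) ^ n ∈ I := by
    choose m hm using hX
    refine ⟨∑ i, m i, fun i => I.pow_mem_of_pow_mem (hm i)
      (Finset.single_le_sum (f := m) (fun _ _ => Nat.zero_le _) (Finset.mem_univ i))⟩
  let N := 3 * n
  let J := {p : Fin 3 × (Fin 3 →₀ ℕ) // p.2.degree + d p.1 = N}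
  let c : J → Exponents N → K := fun p u => (monomial p.1.2 1 * f p.1.1).coeff u.1
  have hspan : Submodule.span K (Set.range c) = ⊤ := by
    rw [eq_top_iff, ← (Pi.basisFun K (Exponents N)).span_eq, Submodule.span_le]
    rintro _ ⟨w, rfl⟩
    have hw : monomial w.1 (1 : K) ∈ I := monomial_mem_of_X_pow_mem hn w.2.ge
    rw [hI, Ideal.mem_span_range_iff_exists_fun] at hw
    obtain ⟨a, ha⟩ := hw
    have key : (Pi.basisFun K (Exponents N)) w = ∑ i, ∑ v ∈ (a i).support,
        (a i).coeff v • fun u : Exponents N => (monomial v 1 * f i).coeff u.1 := by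
      funext u
      have h1 := congrArg (coeff u.1) ha
      rw [coeff_monomial, coeff_sum] at h1
      rw [Pi.basisFun_apply, Pi.single_apply, Finset.sum_apply]
      simp only [Finset.sum_apply, Pi.smul_apply, smul_eq_mul]
      rw [show (if u = w then (1 : K) else 0) = if w.1 = u.1 then 1 else 0 by
        simp [Subtype.ext_iff, eq_comm], ← h1]
      refine Finset.sum_congr rfl fun i _ => ?_
      conv_lhs => rw [(a i).as_sum, Finset.sum_mul, coeff_sum]
      refine Finset.sum_congr rfl fun v _ => ?_
      rw [← coeff_C_mul, ← mul_assoc, C_mul_monomial, mul_one]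
    rw [key]
    refine Submodule.sum_mem _ fun i _ => Submodule.sum_mem _ fun v _ =>
      Submodule.smul_mem _ _ ?_
    -- Only the part of degree `N` of the combination matters: products of any other degree have
    -- zero coefficient vector.
    by_cases hv : v.degree + d i = N
    · exact Submodule.subset_span ⟨⟨(i, v), hv⟩, rfl⟩
    · convert Submodule.zero_mem _
      rename_i u
      exact ((isHomogeneous_monomial (R := K) 1 rfl).mul (hf i)).coeff_eq_zero
        (fun hu => hv (hu ▸ u.2))
  obtain ⟨κ, a, -, ha, hli⟩ := exists_linearIndependent' K c
  let b : Module.Basis κ K (Exponents N → K) := .mk hli (by rw [ha, hspan])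
  let e : Exponents N ≃ κ := (Pi.basisFun K (Exponents N)).indexEquiv b
  refine ⟨N, fun u => (a (e u)).1, fun u => (a (e u)).2, ?_⟩
  have hli' : LinearIndependent K (macaulayMatrix (fun u => (a (e u)).1) f).col :=
    hli.comp e e.injective
  rw [Matrix.linearIndependent_cols_iff_isUnit, Matrix.isUnit_iff_isUnit_det] at hli'
  exact hli'.ne_zero

/-! ### Macaulay's determinant that has minimal degree in one of the forms. -/

/-- Multipliers of Macaulay's matrix in degree `∑ i, d i`, the form `k` being used as seldom as
possible. -/
noncomputable def macaulayChoice (d : Fin 3 → ℕ) (k : Fin 3) (u : Exponents (∑ i, d i)) :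
    Fin 3 × (Fin 3 →₀ ℕ) :=
  open scoped Classical in
  let i := if h : ∃ j, j ≠ k ∧ d j ≤ u.1 j then h.choose else k
  (i, u.1 - Finsupp.single i (d i))

theorem le_macaulayChoice (k : Fin 3) (u : Exponents (∑ i, d i)) :
    d (macaulayChoice d k u).1 ≤ u.1 (macaulayChoice d k u).1 := by
  classical
  simp only [macaulayChoice]
  split_ifs with h
  · exact h.choose_spec.2
  · push Not at h
    by_contra! hk
    have hu := u.2
    rw [Finsupp.degree_eq_sum] at hu
    -- Pigeonhole: if every exponent were smaller than the corresponding degree, the total could not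
    -- be `∑ i, d i`.
    refine absurd hu (ne_of_lt (Finset.sum_lt_sum (fun j _ => ?_) ⟨k, Finset.mem_univ k, hk⟩))
    by_cases hj : j = k
    · exact hj ▸ hk.le
    · exact (h j hj).le

theorem lt_of_macaulayChoice_eq {k : Fin 3} {u : Exponents (∑ i, d i)}
    (h : (macaulayChoice d k u).1 = k) {j : Fin 3} (hj : j ≠ k) : u.1 j < d j := by
  classical
  simp only [macaulayChoice] at h
  split_ifs at h with h'
  · exact absurd h h'.choose_spec.1
  · push Not at h'
    exact h' j hj

theorem macaulayChoice_add (k : Fin 3) (u : Exponents (∑ i, d i)) :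
    (macaulayChoice d k u).2 +
      Finsupp.single (macaulayChoice d k u).1 (d (macaulayChoice d k u).1) = u.1 :=
  tsub_add_cancel_of_le (Finsupp.single_le_iff.mpr (le_macaulayChoice k u))

theorem degree_macaulayChoice (k : Fin 3) (u : Exponents (∑ i, d i)) :
    (macaulayChoice d k u).2.degree + d (macaulayChoice d k u).1 = ∑ i, d i := by
  have := congrArg Finsupp.degree (macaulayChoice_add k u)
  rw [u.2] at this
  simpa using this

-- The column of `w` is the coefficient vector of the monomial `x ^ w` itself, so the matrix is the
-- identity.
open scoped Classical in
theorem det_macaulayMatrix_X_pow (k : Fin 3) :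
    (macaulayMatrix (macaulayChoice d k) fun i => (X i ^ d i : MvPolynomial (Fin 3) S)).det = 1 := by
  convert Matrix.det_one (n := Exponents (∑ i, d i)) (R := S)
  ext u w
  simp only [macaulayMatrix, Matrix.of_apply, X_pow_eq_monomial, monomial_mul, macaulayChoice_add,
    coeff_monomial, Matrix.one_apply, mul_one, Subtype.ext_iff, eq_comm]

/-- The degree in the coefficients of the form `k` of the resultant. -/
def blockDegree (d : Fin 3 → ℕ) (k : Fin 3) : ℕ := ∏ i, if i = k then 1 else d i

/-- The form `k` is used only if all other exponents satisfy `u j < d j`. These exponents determine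
the remaining one, because the total degree is fixed. -/
theorem card_macaulayChoice_eq_le (k : Fin 3) :
    Fintype.card {u : Exponents (∑ i, d i) // (macaulayChoice d k u).1 = k} ≤ blockDegree d k := by
  classical
  let s : Finset (Fin 3 → ℕ) := Fintype.piFinset fun i => if i = k then {0} else Finset.range (d i)
  have hs : s.card = blockDegree d k := by
    rw [Fintype.card_piFinset, blockDegree]
    exact Finset.prod_congr rfl fun i _ => by split_ifs <;> simp
  rw [← hs, ← Fintype.card_coe]
  refine Fintype.card_le_of_injective
    (fun u => ⟨fun i => if i = k then 0 else u.1.1 i, ?_⟩) fun u w h => ?_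
  · rw [Fintype.mem_piFinset]
    intro i
    by_cases hi : i = k
    · simp [hi]
    · simpa [hi] using lt_of_macaulayChoice_eq u.2 hi
  · have h1 : ∀ i, i ≠ k → u.1.1 i = w.1.1 i := fun i hi => by
      simpa [hi] using congrFun (congrArg Subtype.val h) i
    have h2 := u.1.2.trans w.1.2.symm
    rw [Finsupp.degree_eq_sum, Finsupp.degree_eq_sum,
      ← Finset.add_sum_erase _ u.1.1 (Finset.mem_univ k),
      ← Finset.add_sum_erase _ w.1.1 (Finset.mem_univ k), Finset.sum_congr rfl fun i hi => h1 i (Finset.ne_of_mem_erase hi), add_left_inj] at h2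
    refine Subtype.ext (Subtype.ext (Finsupp.ext fun i => ?_))
    by_cases hi : i = k
    · exact hi ▸ h2
    · exact h1 i hi

/-- Multiplication of the form `k` by a scalar. -/
noncomputable def scaleAt (k : Fin 3) (c : S) (f : Fin 3 → MvPolynomial (Fin 3) S) (i : Fin 3) :
    MvPolynomial (Fin 3) S :=
  if i = k then C c * f i else f i

theorem isHomogeneous_scaleAt (k : Fin 3) (c : S) {f : Fin 3 → MvPolynomial (Fin 3) S}
    (hf : ∀ i, (f i).IsHomogeneous (d i)) (i : Fin 3) : (scaleAt k c f i).IsHomogeneous (d i) := by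
  rw [scaleAt]
  split_ifs
  · simpa using (isHomogeneous_C (Fin 3) c).mul (hf i)
  · exact hf i

open scoped Classical in
theorem det_macaulayMatrix_scaleAt (k : Fin 3) (c : S) (f : Fin 3 → MvPolynomial (Fin 3) S) :
    (macaulayMatrix (macaulayChoice d k) (scaleAt k c f)).det =
      c ^ Fintype.card {u : Exponents (∑ i, d i) // (macaulayChoice d k u).1 = k} *
        (macaulayMatrix (macaulayChoice d k) f).det := by
  have : macaulayMatrix (macaulayChoice d k) (scaleAt k c f) = .of fun u w =>
      (if (macaulayChoice d k w).1 = k then c else 1) * macaulayMatrix (macaulayChoice d k) f u w := by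
    ext u w
    simp only [macaulayMatrix, Matrix.of_apply, scaleAt]
    split_ifs
    · rw [mul_left_comm, coeff_C_mul]
    · rw [one_mul]
  rw [this, Matrix.det_mul_row, Finset.prod_ite, Finset.prod_const, Finset.prod_const_one, mul_one,
    Fintype.card_subtype]

/-! ### Prime ideals that contain no polynomial free of a given variable -/

theorem exists_prime_dvd_mem {A : Type*} [CommRing A] [IsDomain A] [UniqueFactorizationMonoid A]
    {I : Ideal A} (hI : I.IsPrime) {a : A} (ha : a ∈ I) (ha0 : a ≠ 0) :
    ∃ p ∈ I, Prime p ∧ p ∣ a := by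
  have h : (UniqueFactorizationMonoid.factors a).prod ∈ I := by
    obtain ⟨u, hu⟩ := UniqueFactorizationMonoid.factors_prod ha0
    rwa [← hu, Ideal.mul_unit_mem_iff_mem _ u.isUnit] at ha
  obtain ⟨p, hp, hpI⟩ := (hI.multiset_prod_mem_iff_exists_mem _).1 h
  exact ⟨p, hpI, UniqueFactorizationMonoid.prime_of_factor p hp,
    UniqueFactorizationMonoid.dvd_of_mem_factors hp⟩

/-- A nonzero prime ideal of `A[X]` that meets `A` in zero is principal if `A` is factorial. -/
theorem exists_prime_span_singleton {A : Type*} [CommRing A] [IsDomain A]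
    [UniqueFactorizationMonoid A] (I : Ideal (Polynomial A)) [hI : I.IsPrime] (hne : I ≠ ⊥)
    (h : ∀ a, Polynomial.C a ∈ I → a = 0) : ∃ r, Prime r ∧ I = Ideal.span {r} := by
  obtain ⟨r, ⟨hr, hr0⟩, hmin⟩ : ∃ r, (r ∈ I ∧ r ≠ 0) ∧
      ∀ q, q ∈ I ∧ q ≠ 0 → r.natDegree ≤ q.natDegree := by
    obtain ⟨p, hp⟩ := Submodule.exists_mem_ne_zero_of_ne_bot hne
    obtain ⟨r, hr, hm⟩ := (measure (Polynomial.natDegree (R := A))).wf.has_min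
      {q | q ∈ I ∧ q ≠ 0} ⟨p, hp⟩
    exact ⟨r, hr, fun q hq => not_lt.mp (hm q hq)⟩
  -- A prime factor in the ideal still has minimal degree. That degree is positive since the ideal
  -- meets the constants in zero; hence `p` does not divide its own leading coefficient, which can
  -- therefore be cancelled after pseudo-division.
  obtain ⟨p, hpI, hp, hpr⟩ := exists_prime_dvd_mem hI hr hr0
  have hpmin : ∀ q ∈ I, q ≠ 0 → p.natDegree ≤ q.natDegree := fun q hq hq0 =>
    (Polynomial.natDegree_le_of_dvd hpr hr0).trans (hmin q ⟨hq, hq0⟩)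
  have hdeg : 0 < p.natDegree := by
    by_contra! hd
    rw [Polynomial.eq_C_of_natDegree_le_zero hd] at hpI hp
    exact hp.ne_zero (by rw [h _ hpI, map_zero])
  have hlc : ¬ p ∣ Polynomial.C p.leadingCoeff := fun hdvd => by
    have := Polynomial.natDegree_le_of_dvd hdvd (by simpa using hp.ne_zero)
    rw [Polynomial.natDegree_C] at this
    omega
  refine ⟨p, hp, le_antisymm (fun q hq => ?_) ((Ideal.span_singleton_le_iff_mem _).mpr hpI)⟩
  rw [Ideal.mem_span_singleton]
  induction hn : q.natDegree using Nat.strong_induction_on generalizing q with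
  | _ n ih =>
    by_cases hq0 : q = 0
    · simp [hq0]
    have hle := hpmin q hq hq0
    -- One step of pseudo-division by `p`; the leading terms cancel, so induction on the degree
    -- applies.
    let q' := Polynomial.C p.leadingCoeff * q -
      Polynomial.C q.leadingCoeff * Polynomial.X ^ (q.natDegree - p.natDegree) * p
    have hq' : q' ∈ I := I.sub_mem (I.mul_mem_left _ hq) (I.mul_mem_left _ hpI)
    have hdvd : p ∣ q' := by
      by_cases hq'0 : q' = 0
      · simp [hq'0]
      refine ih _ ?_ _ hq' rfl
      have hlt : q'.degree < (Polynomial.C p.leadingCoeff * q).degree := by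
        refine Polynomial.degree_sub_lt_left ?_ (by simp [hp.ne_zero, hq0]) ?_
        · rw [Polynomial.degree_mul, Polynomial.degree_mul, Polynomial.degree_mul,
            Polynomial.degree_C (by simpa using hp.ne_zero), Polynomial.degree_C (by simpa using hq0),
            Polynomial.degree_X_pow, Polynomial.degree_eq_natDegree hp.ne_zero,
            Polynomial.degree_eq_natDegree hq0, zero_add, zero_add, ← Nat.cast_add,
            Nat.sub_add_cancel hle]
        · simp only [Polynomial.leadingCoeff_mul, Polynomial.leadingCoeff_C,
            Polynomial.leadingCoeff_X_pow, mul_one]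
          exact mul_comm _ _
      have := Polynomial.natDegree_lt_natDegree hq'0 hlt
      rwa [Polynomial.natDegree_C_mul (by simpa using hp.ne_zero), hn] at this
    have : p ∣ Polynomial.C p.leadingCoeff * q := by
      have := dvd_add hdvd (Dvd.intro_left (Polynomial.C q.leadingCoeff *
        Polynomial.X ^ (q.natDegree - p.natDegree)) (rfl : _ * p = _))
      simpa [q'] using this
    exact (hp.dvd_or_dvd this).resolve_left hlc

/-- The ring is a polynomial ring in the variable `v` over the factorial ring of polynomials in the
remaining variables. -/
theorem exists_prime_span_singleton_of_rename {σ : Type*} (I : Ideal (MvPolynomial σ ℤ))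
    [hI : I.IsPrime] (hne : I ≠ ⊥) (v : σ)
    (h : ∀ s : MvPolynomial {w // w ≠ v} ℤ, rename (↑) s ∈ I → s = 0) :
    ∃ r, Prime r ∧ I = Ideal.span {r} := by
  classical
  let Φ : MvPolynomial σ ℤ ≃ₐ[ℤ] Polynomial (MvPolynomial {w // w ≠ v} ℤ) :=
    (renameEquiv ℤ (Equiv.optionSubtypeNe v).symm).trans (optionEquivLeft ℤ _)
  have hΦ : ∀ s, Φ.symm (Polynomial.C s) = rename (↑) s := fun s => by
    rw [AlgEquiv.symm_apply_eq]
    simp only [Φ, AlgEquiv.trans_apply, renameEquiv_apply, rename_rename]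
    have : (⇑(Equiv.optionSubtypeNe v).symm ∘ ((↑) : {w // w ≠ v} → σ)) = some := by
      funext w
      simp [w.2]
    rw [this]
    induction s using MvPolynomial.induction_on with
    | C a => simp
    | add p q hp hq => simp [← hp, ← hq]
    | mul_X p i hp => simp [← hp]
  let J := I.comap (Φ.symm : Polynomial (MvPolynomial {w // w ≠ v} ℤ) →ₐ[ℤ] MvPolynomial σ ℤ)
  have hJ : J.IsPrime := Ideal.comap_isPrime _ _
  have hJne : J ≠ ⊥ := by
    obtain ⟨p, hp, hp0⟩ := Submodule.exists_mem_ne_zero_of_ne_bot hne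
    exact (Submodule.ne_bot_iff _).mpr ⟨Φ p, by simpa [J, Ideal.mem_comap] using hp, by simpa⟩
  obtain ⟨r, hr, hJr⟩ := exists_prime_span_singleton J hJne fun a ha =>
    h a (by simpa [J, Ideal.mem_comap, hΦ] using ha)
  refine ⟨Φ.symm r, (MulEquiv.prime_iff (Φ.symm : _ ≃* MvPolynomial σ ℤ)).mpr hr, ?_⟩
  ext p
  have : p ∈ I ↔ Φ p ∈ J := by simp [J, Ideal.mem_comap]
  rw [this, hJr, Ideal.mem_span_singleton, Ideal.mem_span_singleton]
  exact ⟨fun hd => by simpa using map_dvd Φ.symm hd, fun hd => by simpa using map_dvd Φ hd⟩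

/-! ### The ideal of polynomials vanishing on triples with a common zero -/

/-- The form `ℓ(z) ^ n * f - f(z) * ℓ ^ n`, which vanishes at `z`; here `ℓ = ∑ i, l i * x i`. -/
noncomputable def forceZero (n : ℕ) (f : MvPolynomial (Fin 3) S) (z l : Fin 3 → S) :
    MvPolynomial (Fin 3) S :=
  C ((∑ i, l i * z i) ^ n) * f - C (eval z f) * (∑ i, C (l i) * X i) ^ n

theorem isHomogeneous_linearForm (l : Fin 3 → S) :
    (∑ i, C (l i) * X i : MvPolynomial (Fin 3) S).IsHomogeneous 1 :=
  IsHomogeneous.sum _ _ _ fun i _ => (isHomogeneous_X S i).C_mul _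

theorem isHomogeneous_forceZero {n : ℕ} {f : MvPolynomial (Fin 3) S} (hf : f.IsHomogeneous n)
    (z l : Fin 3 → S) : (forceZero n f z l).IsHomogeneous n := by
  refine IsHomogeneous.sub ?_ ?_
  · exact hf.C_mul _
  · have := (isHomogeneous_linearForm l).pow n
    rw [one_mul] at this
    exact this.C_mul _

theorem eval_forceZero (n : ℕ) (f : MvPolynomial (Fin 3) S) (z l : Fin 3 → S) :
    eval z (forceZero n f z l) = 0 := by
  simp [forceZero, mul_comm]

theorem map_forceZero (φ : S →+* T) (n : ℕ) (f : MvPolynomial (Fin 3) S) (z l : Fin 3 → S) :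
    map φ (forceZero n f z l) = forceZero n (map φ f) (fun i => φ (z i)) fun i => φ (l i) := by
  simp only [forceZero, map_sub, map_mul, map_pow, map_C, map_sum, map_X, map_eval_point φ]

/-- Substitution of the generic triple of forms with a common zero. -/
noncomputable def incidenceHom (d : Fin 3 → ℕ) :
    MvPolynomial (CoeffIndex d) ℤ →+* MvPolynomial (CoeffIndex d ⊕ (Fin 3 ⊕ Fin 3)) ℤ :=
  subst fun v => (forceZero (d v.1) (ofCoeffs fun u : Exponents (d v.1) => X (.inl ⟨v.1, u⟩))
    (fun i => X (.inr (.inl i))) fun i => X (.inr (.inr i))).coeff v.2.1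

theorem incidenceHom_apply (P : MvPolynomial (CoeffIndex d) ℤ) :
    incidenceHom d P = evalForms P fun i => forceZero (d i)
      (ofCoeffs fun u : Exponents (d i) => X (.inl ⟨i, u⟩))
      (fun i => X (.inr (.inl i))) fun i => X (.inr (.inr i)) := rfl

theorem evalForms_forceZero_eq_zero {P : MvPolynomial (CoeffIndex d) ℤ}
    (hP : incidenceHom d P = 0) {f : Fin 3 → MvPolynomial (Fin 3) S}
    (hf : ∀ i, (f i).IsHomogeneous (d i)) (z l : Fin 3 → S) :
    evalForms P (fun i => forceZero (d i) (f i) z l) = 0 := by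
  let φ : MvPolynomial (CoeffIndex d ⊕ (Fin 3 ⊕ Fin 3)) ℤ →+* S :=
    subst (Sum.elim (fun v => (f v.1).coeff v.2.1) (Sum.elim z l))
  have h := congrArg φ hP
  rw [incidenceHom_apply, map_evalForms, map_zero] at h
  simpa [map_forceZero, map_ofCoeffs, φ, ofCoeffs_coeff (hf _)] using h

/-- Every triple with a common zero `z` is a specialization of the generic one: for the linear form
`ℓ = x_j / z_j` one has `ℓ(z) = 1`, and `forceZero` returns forms vanishing at `z` unchanged. The
division is the reason for passing to the fraction field. -/
theorem evalForms_eq_zero_of_incidenceHom [IsDomain S] {P : MvPolynomial (CoeffIndex d) ℤ}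
    (hP : incidenceHom d P = 0) {f : Fin 3 → MvPolynomial (Fin 3) S}
    (hf : ∀ i, (f i).IsHomogeneous (d i)) (h : HasCommonZero f) : evalForms P f = 0 := by
  obtain ⟨z, hz, hzf⟩ := h
  obtain ⟨j, hj⟩ := Function.ne_iff.mp hz
  let φ := algebraMap S (FractionRing S)
  have hφ : Function.Injective φ := IsFractionRing.injective _ _
  apply hφ
  rw [map_evalForms, map_zero]
  have hfz : ∀ i, forceZero (d i) (map φ (f i)) (fun i => φ (z i)) (Pi.single j (φ (z j))⁻¹) =
      map φ (f i) := fun i => by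
    have h1 : eval (fun i => φ (z i)) (map φ (f i)) = 0 := by
      rw [← map_eval_point, hzf, map_zero]
    have h2 : φ (z j) ≠ 0 := by simpa using (map_ne_zero_iff φ hφ).mpr hj
    simp [forceZero, h1, Pi.single_apply, inv_mul_cancel₀ h2]
  have := evalForms_forceZero_eq_zero hP (fun i => (hf i).map φ) (fun i => φ (z i))
    (Pi.single j (φ (z j))⁻¹)
  simpa only [hfz] using this

theorem incidenceHom_macaulayDet {N : ℕ} {g : Exponents N → Fin 3 × (Fin 3 →₀ ℕ)}
    (hg : ∀ u, (g u).2.degree + d (g u).1 = N) : incidenceHom d (macaulayDet d g) = 0 := by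
  have hh : ∀ i, (forceZero (d i) (ofCoeffs fun u : Exponents (d i) =>
      (X (.inl ⟨i, u⟩) : MvPolynomial (CoeffIndex d ⊕ (Fin 3 ⊕ Fin 3)) ℤ))
      (fun i => X (.inr (.inl i))) fun i => X (.inr (.inr i))).IsHomogeneous (d i) :=
    fun i => isHomogeneous_forceZero (isHomogeneous_ofCoeffs _) _ _
  rw [incidenceHom_apply, evalForms_macaulayDet g hh]
  exact det_macaulayMatrix_eq_zero hg hh ⟨_, Function.ne_iff.mpr ⟨0, X_ne_zero _⟩,
    fun i => eval_forceZero _ _ _ _⟩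

theorem exists_subst_ne_zero {σ : Type*} {P : MvPolynomial σ ℤ} (hP : P ≠ 0) :
    ∃ c : σ → ℂ, subst c P ≠ 0 := by
  by_contra! h
  refine hP (map_injective (Int.castRingHom ℂ) Int.cast_injective ?_)
  refine MvPolynomial.funext fun c => ?_
  rw [map_zero, map_zero, eval_map]
  exact h c

/-! ### Two plane curves meet -/

section Krull

variable {K : Type*} [Field K]

/-- Setting more and more variables to zero gives the strict chain of primes `0 < (x₀) < (x₀, x₁) <
(x₀, x₁, x₂)` as kernels of substitutions. -/
theorem three_le_height_vanishingIdeal_zero :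
    3 ≤ (vanishingIdeal K {(0 : Fin 3 → K)}).height := by
  let φ : (Fin 3 → Prop) → MvPolynomial (Fin 3) K →ₐ[K] MvPolynomial (Fin 3) K := fun s =>
    open scoped Classical in aeval fun i => if s i then 0 else X i
  have hprime : ∀ s, (RingHom.ker (φ s)).IsPrime := fun s => RingHom.ker_isPrime _
  have hcomp : ∀ s t : Fin 3 → Prop, (∀ i, s i → t i) → (φ t).comp (φ s) = φ t := by
    intro s t hst
    ext1 i
    by_cases hs : s i
    · simp [φ, hs, hst i hs]
    · simp [φ, hs]
  have hlt : ∀ (s t : Fin 3 → Prop) (j : Fin 3), (∀ i, s i → t i) → ¬ s j → t j →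
      RingHom.ker (φ s) < RingHom.ker (φ t) := by
    intro s t j hst hsj htj
    refine lt_of_le_of_ne (fun p hp => ?_) fun heq => ?_
    · rw [RingHom.mem_ker] at hp ⊢
      rw [← hcomp s t hst, AlgHom.comp_apply, hp, map_zero]
    · have : (X j : MvPolynomial (Fin 3) K) ∈ RingHom.ker (φ s) := by
        rw [heq, RingHom.mem_ker]
        simp [φ, htj]
      rw [RingHom.mem_ker] at this
      simp [φ, hsj, X_ne_zero] at this
  have hle : RingHom.ker (φ fun _ => True) ≤ vanishingIdeal K {(0 : Fin 3 → K)} := by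
    intro p hp
    rw [mem_vanishingIdeal_singleton_iff]
    have h1 : (aeval (0 : Fin 3 → K)).comp (φ fun _ => True) = aeval (0 : Fin 3 → K) := by
      ext1 i
      simp [φ]
    rw [← h1, AlgHom.comp_apply, RingHom.mem_ker.mp hp, map_zero]
  have h1 := Ideal.height_strict_mono_of_isPrime (hlt (fun _ => False) (· = 0) 0
    (by simp) (by simp) rfl)
  have h2 := Ideal.height_strict_mono_of_isPrime (hlt (· = 0) (· ≠ 2) 1
    (by simp) (by simp) (by simp))
  have h3 := Ideal.height_strict_mono_of_isPrime (hlt (· ≠ 2) (fun _ => True) 2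
    (by simp) (by simp) (by simp))
  have h4 := Ideal.height_mono hle
  have h1' := (add_le_add_left (zero_le (a := (RingHom.ker (φ fun _ => False)).height)) 1).trans
    (Order.add_one_le_of_lt h1)
  have h2' := (add_le_add_left h1' 1).trans (Order.add_one_le_of_lt h2)
  have h3' := (add_le_add_left h2' 1).trans (Order.add_one_le_of_lt h3)
  exact le_trans (by norm_num) (h3'.trans h4)

/-- Two forms of positive degree in three variables have a common zero. -/
theorem exists_common_zero_pair [IsAlgClosed K] {f g : MvPolynomial (Fin 3) K}
    (hf : eval 0 f = 0) (hg : eval 0 g = 0) :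
    ∃ z : Fin 3 → K, z ≠ 0 ∧ eval z f = 0 ∧ eval z g = 0 := by
  classical
  by_contra! h
  let s : Finset (MvPolynomial (Fin 3) K) := {f, g}
  -- If the origin were the only common zero, its ideal would be a minimal prime over two
  -- generators, hence of height at most 2 by Krull's theorem.
  have hmin : vanishingIdeal K {(0 : Fin 3 → K)} ∈
      (Ideal.span (s : Set (MvPolynomial (Fin 3) K))).minimalPrimes := by
    refine ⟨⟨inferInstance, Ideal.span_le.mpr ?_⟩, fun q hq _ => ?_⟩
    · intro p hp
      simp only [s, Finset.coe_insert, Finset.coe_singleton, Set.mem_insert_iff,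
        Set.mem_singleton_iff] at hp
      rw [SetLike.mem_coe, mem_vanishingIdeal_singleton_iff, aeval_eq_eval]
      rcases hp with rfl | rfl <;> assumption
    · have hrad := (hq.1.radical_le_iff).mpr hq.2
      rw [← vanishingIdeal_zeroLocus_eq_radical (K := K), zeroLocus_span] at hrad
      refine le_trans (vanishingIdeal_anti_mono fun z hz => ?_) hrad
      by_contra hne
      have h1 := hz f (by simp [s])
      have h2 := hz g (by simp [s])
      rw [aeval_eq_eval] at h1 h2
      exact h z hne h1 h2
  have h1 := Ideal.height_le_card_of_mem_minimalPrimes_span_finset hmin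
  have h2 : s.card ≤ 2 := Finset.card_le_two
  have h3 := (three_le_height_vanishingIdeal_zero (K := K)).trans h1
  have : (3 : ℕ) ≤ s.card := by exact_mod_cast h3
  omega

end Krull

/-! ### Existence of the resultant -/

/-- The exponent of `xᵢ ^ n`. -/
noncomputable def pureExponent (i : Fin 3) (n : ℕ) : Exponents n := ⟨Finsupp.single i n, by simp⟩

/-- Generically the last two forms have no common zero on the line `x₀ = 0`. -/
theorem exists_ne_zero_of_common_zero_on_line (d : Fin 3 → ℕ) :
    ∃ D : MvPolynomial (CoeffIndex d) ℤ, D ≠ 0 ∧ ∀ f : Fin 3 → MvPolynomial (Fin 3) ℂ,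
      (∀ i, (f i).IsHomogeneous (d i)) → ∀ z : Fin 3 → ℂ, z ≠ 0 → z 0 = 0 →
        eval z (f 1) = 0 → eval z (f 2) = 0 → evalForms D f = 0 := by
  classical
  -- The polynomial `D` is Macaulay's determinant of `x₀` and the last two generic forms. It equals
  -- 1 when these are powers of `x₁` and `x₂`.
  let e : Fin 3 → ℕ := Function.update d 0 1
  have hD : ∀ {S : Type} [CommRing S] (f : Fin 3 → MvPolynomial (Fin 3) S),
      (∀ i, (f i).IsHomogeneous (d i)) →
      evalForms (macaulayMatrix (macaulayChoice e 0)
        (Function.update (genericForms d) 0 (X 0))).det f =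
        (macaulayMatrix (macaulayChoice e 0) (Function.update f 0 (X 0))).det := by
    intro S _ f hf
    rw [evalForms, map_det_macaulayMatrix]
    congr 2
    funext i
    by_cases hi : i = 0
    · subst hi
      simp
    · simp [hi, map_subst_genericForms hf]
  refine ⟨_, fun h0 => ?_, fun f hf z hz hz0 hz1 hz2 => (hD f hf).trans ?_⟩
  · have h1 := hD (fun i => (X i ^ d i : MvPolynomial (Fin 3) ℤ)) fun i => isHomogeneous_X_pow _ _
    have h2 : Function.update (fun i => (X i ^ d i : MvPolynomial (Fin 3) ℤ)) 0 (X 0) =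
        fun i => X i ^ e i := by
      funext i
      by_cases hi : i = 0
      · subst hi
        simp [e]
      · simp [hi, e]
    rw [h0, evalForms_zero, h2, det_macaulayMatrix_X_pow] at h1
    exact zero_ne_one h1
  · refine det_macaulayMatrix_eq_zero (d := e) (degree_macaulayChoice 0) (fun i => ?_)
      ⟨z, hz, fun i => ?_⟩
    · by_cases hi : i = 0
      · subst hi
        simpa [e] using isHomogeneous_X ℂ 0
      · simpa [hi, e] using hf i
    · fin_cases i
      · simpa using hz0
      · simpa using hz1
      · simpa using hz2

/-- The coefficients of the three forms other than that of `x₀ ^ (d 0)` in the first are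
algebraically independent on triples with a common zero. -/
theorem eq_zero_of_incidenceHom_rename (hd : ∀ i, 0 < d i)
    (s : MvPolynomial {w : CoeffIndex d // w ≠ ⟨0, pureExponent 0 (d 0)⟩} ℤ)
    (h : incidenceHom d (rename Subtype.val s) = 0) : s = 0 := by
  classical
  by_contra hs
  obtain ⟨D, hD0, hD⟩ := exists_ne_zero_of_common_zero_on_line d
  have hP0 : rename Subtype.val s ≠ 0 :=
    (map_ne_zero_iff _ (rename_injective _ Subtype.val_injective)).mpr hs
  -- At such a triple `s` is nonzero, and `D ≠ 0` forces `z 0 ≠ 0` at any common zero `z` of the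
  -- last two forms. Changing the coefficient of `x₀ ^ d₀` then makes the first form vanish at `z`.
  -- This does not affect `s`, which must nevertheless vanish on the new triple.
  obtain ⟨c, hc⟩ := exists_subst_ne_zero (mul_ne_zero hP0 hD0)
  rw [map_mul] at hc
  obtain ⟨f, hf, hfc⟩ : ∃ f : Fin 3 → MvPolynomial (Fin 3) ℂ, (∀ i, (f i).IsHomogeneous (d i)) ∧
      (fun v : CoeffIndex d => (f v.1).coeff v.2.1) = c :=
    ⟨fun i => ofCoeffs fun u : Exponents (d i) => c ⟨i, u⟩, fun i => isHomogeneous_ofCoeffs _,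
      funext fun v => coeff_ofCoeffs _ v.2⟩
  have hf0 : ∀ i, eval 0 (f i) = 0 := fun i => by
    rw [MvPolynomial.eval_zero, constantCoeff_eq]
    exact (hf i).coeff_eq_zero (by simpa using (hd i).ne)
  obtain ⟨z, hz, hz1, hz2⟩ := exists_common_zero_pair (hf0 1) (hf0 2)
  have hz0 : z 0 ≠ 0 := fun hz0 => right_ne_zero_of_mul hc (by
    rw [← hfc]
    exact hD f hf z hz hz0 hz1 hz2)
  obtain ⟨a, ha⟩ : ∃ a, a * z 0 ^ d 0 = eval z (f 0) :=
    ⟨eval z (f 0) / z 0 ^ d 0, div_mul_cancel₀ _ (pow_ne_zero _ hz0)⟩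
  let fmod : Fin 3 → MvPolynomial (Fin 3) ℂ := Function.update f 0 (f 0 - C a * X 0 ^ d 0)
  have hf' : ∀ i, (fmod i).IsHomogeneous (d i) := fun i => by
    by_cases hi : i = 0
    · subst hi
      simpa [fmod] using (hf 0).sub ((isHomogeneous_X_pow _ _).C_mul _)
    · simpa [fmod, hi] using hf i
  have h1 := evalForms_eq_zero_of_incidenceHom h hf' ⟨z, hz, fun i => by
    fin_cases i
    · simp [fmod, ha]
    · simpa [fmod] using hz1
    · simpa [fmod] using hz2⟩
  refine left_ne_zero_of_mul hc ?_
  rw [evalForms, subst_rename] at h1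
  rw [subst_rename, ← h1, ← hfc]
  congr 2
  funext v
  obtain ⟨⟨i, u⟩, hv⟩ := v
  by_cases hi : i = 0
  · subst hi
    have hu : Finsupp.single 0 (d 0) ≠ u.1 := fun hu => hv (by
      rw [show u = pureExponent 0 (d 0) from Subtype.ext hu.symm])
    simp [fmod, X_pow_eq_monomial, C_mul_monomial, coeff_monomial, hu]
  · simp [fmod, hi]

/-- The ideal of integer polynomials vanishing on triples with a common zero is generated by a
prime element taking the value `1` at `(x₀ ^ d₀, x₁ ^ d₁, x₂ ^ d₂)`. -/
theorem exists_prime_ker_incidenceHom (hd : ∀ i, 0 < d i) :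
    ∃ R : MvPolynomial (CoeffIndex d) ℤ, Prime R ∧
      evalForms R (fun i => (X i ^ d i : MvPolynomial (Fin 3) ℤ)) = 1 ∧
      RingHom.ker (incidenceHom d) = Ideal.span {R} := by
  classical
  have hker := incidenceHom_macaulayDet (d := d) (degree_macaulayChoice 0)
  have h1 : evalForms (macaulayDet d (macaulayChoice d 0))
      (fun i => (X i ^ d i : MvPolynomial (Fin 3) ℤ)) = 1 := by
    rw [evalForms_macaulayDet _ fun i => isHomogeneous_X_pow _ _, det_macaulayMatrix_X_pow]
  have hprime : (RingHom.ker (incidenceHom d)).IsPrime := RingHom.ker_isPrime _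
  obtain ⟨R, hR, hspan⟩ := exists_prime_span_singleton_of_rename (RingHom.ker (incidenceHom d))
    ((Submodule.ne_bot_iff _).mpr ⟨_, hker, fun h0 => by simp [h0] at h1⟩)
    ⟨0, pureExponent 0 (d 0)⟩ fun s hs => eq_zero_of_incidenceHom_rename hd s hs
  have hdvd : R ∣ macaulayDet d (macaulayChoice d 0) := by
    rw [← Ideal.mem_span_singleton, ← hspan]
    exact hker
  obtain ⟨Q, hQ⟩ := hdvd
  rw [hQ, evalForms_mul] at h1
  -- The generator divides a determinant of value 1, so its integer value is a unit and a change of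
  -- sign normalizes it.
  rcases Int.eq_one_or_neg_one_of_mul_eq_one h1 with h | h
  · exact ⟨R, hR, h, hspan⟩
  · refine ⟨-R, hR.neg, ?_, by rw [hspan, Ideal.span_singleton_neg]⟩
    simpa [evalForms, neg_eq_iff_eq_neg] using h

/-- The resultant of three ternary forms of degrees `d 0, d 1, d 2`, as a polynomial in their
coefficients. -/
noncomputable def resultant (d : Fin 3 → ℕ) : MvPolynomial (CoeffIndex d) ℤ :=
  open scoped Classical in
  if hd : ∀ i, 0 < d i then (exists_prime_ker_incidenceHom hd).choose else 1

/-- The resultant of three ternary forms of degrees `d 0, d 1, d 2`. -/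
noncomputable def res (d : Fin 3 → ℕ) (f : Fin 3 → MvPolynomial (Fin 3) S) : S :=
  evalForms (resultant d) f

theorem resultant_spec (hd : ∀ i, 0 < d i) : Prime (resultant d) ∧
    evalForms (resultant d) (fun i => (X i ^ d i : MvPolynomial (Fin 3) ℤ)) = 1 ∧
    RingHom.ker (incidenceHom d) = Ideal.span {resultant d} := by
  rw [resultant, dif_pos hd]
  exact (exists_prime_ker_incidenceHom hd).choose_spec

theorem map_res (φ : S →+* T) (f : Fin 3 → MvPolynomial (Fin 3) S) :
    φ (res d f) = res d fun i => map φ (f i) := map_evalForms φ _ f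

theorem res_genericForms (d : Fin 3 → ℕ) : res d (genericForms d) = resultant d :=
  evalForms_genericForms _

theorem res_X_pow (hd : ∀ i, 0 < d i) :
    res d (fun i => (X i ^ d i : MvPolynomial (Fin 3) S)) = 1 := by
  have h := map_res (d := d) (Int.castRingHom S) fun i => X i ^ d i
  rw [res, (resultant_spec hd).2.1] at h
  simpa using h.symm

theorem res_eq_zero_of_hasCommonZero [IsDomain S] (hd : ∀ i, 0 < d i)
    {f : Fin 3 → MvPolynomial (Fin 3) S} (hf : ∀ i, (f i).IsHomogeneous (d i))
    (h : HasCommonZero f) : res d f = 0 := by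
  have : resultant d ∈ RingHom.ker (incidenceHom d) := by
    rw [(resultant_spec hd).2.2]
    exact Ideal.mem_span_singleton_self _
  exact evalForms_eq_zero_of_incidenceHom this hf h

theorem resultant_dvd_macaulayDet (hd : ∀ i, 0 < d i) {N : ℕ}
    {g : Exponents N → Fin 3 × (Fin 3 →₀ ℕ)} (hg : ∀ u, (g u).2.degree + d (g u).1 = N) :
    resultant d ∣ macaulayDet d g := by
  rw [← Ideal.mem_span_singleton, ← (resultant_spec hd).2.2]
  exact incidenceHom_macaulayDet hg

/-- All Macaulay determinants are multiples of the resultant, and without a common zero one of them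
is nonzero. No assumption on the characteristic is made, which later gives access to reduction
modulo primes. -/
theorem res_eq_zero_iff {K : Type*} [Field K] [IsAlgClosed K] (hd : ∀ i, 0 < d i)
    {f : Fin 3 → MvPolynomial (Fin 3) K} (hf : ∀ i, (f i).IsHomogeneous (d i)) :
    res d f = 0 ↔ HasCommonZero f := by
  classical
  refine ⟨fun h => ?_, res_eq_zero_of_hasCommonZero hd hf⟩
  by_contra hne
  obtain ⟨N, g, hg, hdet⟩ := exists_det_macaulayMatrix_ne_zero hf hne
  obtain ⟨E, hE⟩ := resultant_dvd_macaulayDet hd hg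
  rw [← evalForms_macaulayDet g hf, hE, evalForms_mul] at hdet
  exact hdet (by rw [← res, h, zero_mul])

/-! ### Polynomials determined by their complex zeros -/

section Nullstellensatz

theorem not_dvd_C_of_subst_eq_zero {σ : Type*} {P : MvPolynomial σ ℤ} {c : σ → ℂ} (hc : subst c P = 0) {N : ℤ}
    (hN : N ≠ 0) : ¬ P ∣ C N := by
  rintro ⟨E, hE⟩
  have := congrArg (subst c) hE
  rw [map_mul, hc, zero_mul, subst, eval₂Hom_C] at this
  simp [hN] at this

variable {σ : Type*} [Finite σ]

/-- This is the Nullstellensatz for ideals over `ℚ` and points over `ℂ`, followed by clearing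
denominators. -/
theorem exists_dvd_C_mul_pow {P Q : MvPolynomial σ ℤ}
    (h : ∀ c : σ → ℂ, subst c P = 0 → subst c Q = 0) :
    ∃ N : ℤ, N ≠ 0 ∧ ∃ n : ℕ, P ∣ C N * Q ^ n := by
  let φ := map (σ := σ) (Int.castRingHom ℚ)
  have hφ : Function.Injective φ := map_injective _ Int.cast_injective
  have hsub : ∀ (c : σ → ℂ) (p : MvPolynomial σ ℤ), aeval c (φ p) = subst c p := fun c p => by
    rw [aeval_def, eval₂_map, subst]
    exact congrArg (fun ψ => eval₂ ψ c p) (RingHom.ext_int _ _)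
  have hrad : φ Q ∈ (Ideal.span {φ P}).radical := by
    rw [← vanishingIdeal_zeroLocus_eq_radical (K := ℂ), zeroLocus_span]
    intro c hc
    have hc' := hc (φ P) rfl
    rw [hsub] at hc' ⊢
    exact h c hc'
  obtain ⟨n, hn⟩ := hrad
  obtain ⟨E, hE⟩ := Ideal.mem_span_singleton.mp hn
  have hden : ∃ N : ℤ, N ≠ 0 ∧ ∃ E' : MvPolynomial σ ℤ, φ E' = C (N : ℚ) * E := by
    clear hE
    induction E using MvPolynomial.induction_on with
    | C a => exact ⟨a.den, by simp, C a.num, by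
        rw [map_C, ← C_mul, Int.cast_natCast, mul_comm, Rat.mul_den_eq_num, Int.coe_castRingHom]⟩
    | add p q hp hq =>
      obtain ⟨M, hM, p', hp⟩ := hp
      obtain ⟨N, hN, q', hq⟩ := hq
      refine ⟨M * N, mul_ne_zero hM hN, C N * p' + C M * q', ?_⟩
      simp only [map_add, map_mul, hp, hq, Int.cast_mul]
      simp only [φ, map_C, Int.coe_castRingHom]
      ring
    | mul_X p i hp =>
      obtain ⟨M, hM, p', hp⟩ := hp
      exact ⟨M, hM, p' * X i, by rw [map_mul, hp, mul_assoc]; simp [φ]⟩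
  obtain ⟨N, hN, E', hE'⟩ := hden
  refine ⟨N, hN, n, E', hφ ?_⟩
  rw [map_mul, map_mul, map_pow, hE', hE]
  simp only [φ, map_C, Int.coe_castRingHom]
  ring

/-- A prime polynomial with a complex zero divides the polynomials vanishing at its zeros. -/
theorem dvd_of_forall_subst_eq_zero {P Q : MvPolynomial σ ℤ} (hP : Prime P) {c : σ → ℂ}
    (hc : subst c P = 0) (h : ∀ c : σ → ℂ, subst c P = 0 → subst c Q = 0) : P ∣ Q := by
  obtain ⟨N, hN, n, hdvd⟩ := exists_dvd_C_mul_pow h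
  exact hP.dvd_of_dvd_pow ((hP.dvd_or_dvd hdvd).resolve_left (not_dvd_C_of_subst_eq_zero hc hN))

/-- By unique factorization a divisor of `C N * Q ^ n` with `N ≠ 0` is a divisor of `N` times a
power of `Q`, up to a unit, and units are constants. -/
theorem exists_eq_C_mul_pow {P Q : MvPolynomial σ ℤ} (hQ : Prime Q)
    (h : ∀ c : σ → ℂ, subst c P = 0 → subst c Q = 0) :
    ∃ (a : ℤ) (n : ℕ), P = C a * Q ^ n := by
  obtain ⟨N, hN, n, hdvd⟩ := exists_dvd_C_mul_pow h
  obtain ⟨A, B, hA, hB, rfl⟩ := exists_dvd_and_dvd_of_dvd_mul hdvd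
  obtain ⟨a, -, rfl⟩ := (dvd_C_iff_exists hN).mp hA
  obtain ⟨m, -, hm⟩ := (dvd_prime_pow hQ n).mp hB
  obtain ⟨u, rfl⟩ := hm.symm
  obtain ⟨b, -, hb⟩ := (dvd_C_iff_exists (f := (u : MvPolynomial σ ℤ)) (one_ne_zero (α := ℤ))).mp
    u.isUnit.dvd
  exact ⟨a * b, m, by rw [hb, C_mul]; ring⟩

end Nullstellensatz

/-! ### Homogeneity of the resultant in the coefficients of each form -/

/-- A divisor of a monomial in one variable is a monomial. -/
theorem eq_X_pow_mul_C_of_mul_eq {A : Type*} [CommRing A] [IsDomain A] {r e : Polynomial A} {m : ℕ}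
    {a : A} (ha : a ≠ 0) (h : r * e = Polynomial.X ^ m * Polynomial.C a) :
    ∃ j ≤ m, r = Polynomial.X ^ j * Polynomial.C (r.eval 1) := by
  have hne : r * e ≠ 0 := by
    rw [h]
    exact mul_ne_zero (pow_ne_zero _ Polynomial.X_ne_zero) (by simpa using ha)
  have hr := left_ne_zero_of_mul hne
  have he := right_ne_zero_of_mul hne
  have h1 : r.natDegree + e.natDegree = m := by
    rw [← Polynomial.natDegree_mul hr he, h, mul_comm, Polynomial.natDegree_C_mul_X_pow _ _ ha]
  -- Degrees and lowest degrees both add up to `m`, so they coincide for each factor.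
  have h2 : r.natTrailingDegree + e.natTrailingDegree = m := by
    rw [← Polynomial.natTrailingDegree_mul hr he, h, mul_comm, Polynomial.C_mul_X_pow_eq_monomial,
      Polynomial.natTrailingDegree_monomial ha]
  have h3 := r.natTrailingDegree_le_natDegree
  have h4 := e.natTrailingDegree_le_natDegree
  have hmon : r = Polynomial.monomial r.natDegree r.leadingCoeff := by
    ext n
    rw [Polynomial.coeff_monomial]
    split_ifs with hn
    · rw [← hn, Polynomial.leadingCoeff]
    · rcases lt_or_gt_of_ne hn with hlt | hlt
      · exact Polynomial.coeff_eq_zero_of_natDegree_lt hlt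
      · exact Polynomial.coeff_eq_zero_of_lt_natTrailingDegree (by omega)
  refine ⟨r.natDegree, by omega, ?_⟩
  have hev : r.eval 1 = r.leadingCoeff := by
    conv_lhs => rw [hmon]
    simp
  rw [hev, mul_comm, Polynomial.C_mul_X_pow_eq_monomial, ← hmon]

theorem evalRingHom_comp_C (t : S) : (Polynomial.evalRingHom t).comp Polynomial.C = RingHom.id S :=
  RingHom.ext fun _ => Polynomial.eval_C

theorem map_scaleAt (φ : S →+* T) (k : Fin 3) (c : S) (f : Fin 3 → MvPolynomial (Fin 3) S)
    (i : Fin 3) : map φ (scaleAt k c f i) = scaleAt k (φ c) (fun i => map φ (f i)) i := by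
  simp only [scaleAt]
  split_ifs <;> simp

/-- Scaling the generic form `k` by an indeterminate multiplies Macaulay's determinant by a power of
it. The resultant, being a divisor, is then a monomial in the indeterminate too, and its coefficient
is found by setting the indeterminate to 1. -/
theorem exists_res_scaleAt (hd : ∀ i, 0 < d i) (k : Fin 3) :
    ∃ j ≤ blockDegree d k, ∀ {S : Type} [CommRing S] (c : S) (f : Fin 3 → MvPolynomial (Fin 3) S),
      (∀ i, (f i).IsHomogeneous (d i)) → res d (scaleAt k c f) = c ^ j * res d f := by
  classical
  let A := MvPolynomial (CoeffIndex d) ℤ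
  let F : Fin 3 → MvPolynomial (Fin 3) (Polynomial A) := fun i =>
    map Polynomial.C (genericForms d i)
  have hF : ∀ i, (F i).IsHomogeneous (d i) := fun i => (isHomogeneous_genericForms d i).map _
  obtain ⟨E, hE⟩ := resultant_dvd_macaulayDet hd (degree_macaulayChoice (d := d) k)
  have hD0 : macaulayDet d (macaulayChoice d k) ≠ 0 := fun h0 => by
    have h1 := evalForms_macaulayDet (macaulayChoice d k)
      (f := fun i => (X i ^ d i : MvPolynomial (Fin 3) ℤ)) fun i => isHomogeneous_X_pow _ _
    rw [det_macaulayMatrix_X_pow, h0, evalForms_zero] at h1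
    exact zero_ne_one h1
  have h1 : res d (scaleAt k Polynomial.X F) * evalForms E (scaleAt k Polynomial.X F) =
      Polynomial.X ^ Fintype.card {u : Exponents (∑ i, d i) // (macaulayChoice d k u).1 = k} *
        Polynomial.C (macaulayDet d (macaulayChoice d k)) := by
    rw [res, ← evalForms_mul, ← hE, evalForms_macaulayDet _ (isHomogeneous_scaleAt k _ hF),
      det_macaulayMatrix_scaleAt, ← evalForms_macaulayDet _ hF]
    congr 1
    rw [← evalForms_genericForms (macaulayDet d (macaulayChoice d k)), map_evalForms,
      evalForms_genericForms]
  obtain ⟨j, hj, hr⟩ := eq_X_pow_mul_C_of_mul_eq hD0 h1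
  refine ⟨j, hj.trans (card_macaulayChoice_eq_le k), fun {S} _ c f hf => ?_⟩
  have h2 : (res d (scaleAt k Polynomial.X F)).eval 1 = resultant d := by
    have := map_res (d := d) (Polynomial.evalRingHom (1 : A)) (scaleAt k Polynomial.X F)
    rw [Polynomial.coe_evalRingHom] at this
    rw [this, ← res_genericForms d]
    congr 1
    funext i
    rw [map_scaleAt]
    simp only [F, map_map, evalRingHom_comp_C, scaleAt, MvPolynomial.map_id]
    split_ifs
    · simp
    · rfl
  rw [h2] at hr
  let φ : A →+* S := subst fun v => (f v.1).coeff v.2.1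
  have h3 := congrArg (Polynomial.eval₂RingHom φ c) hr
  rw [map_res, map_mul, map_pow] at h3
  simp only [map_scaleAt, Polynomial.coe_eval₂RingHom, Polynomial.eval₂_X, Polynomial.eval₂_C, F,
    map_map, Polynomial.eval₂RingHom_comp_C, φ, map_subst_genericForms hf] at h3
  exact h3

theorem isHomogeneous_update {f : Fin 3 → MvPolynomial (Fin 3) S}
    (hf : ∀ i, (f i).IsHomogeneous (d i)) {k : Fin 3} {h : MvPolynomial (Fin 3) S}
    (hh : h.IsHomogeneous (d k)) (i : Fin 3) : (Function.update f k h i).IsHomogeneous (d i) := by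
  by_cases hi : i = k
  · subst hi
    simpa using hh
  · simpa [hi] using hf i

theorem map_update (φ : S →+* T) (f : Fin 3 → MvPolynomial (Fin 3) S) (k : Fin 3)
    (h : MvPolynomial (Fin 3) S) : (fun i => map φ (Function.update f k h i)) =
      Function.update (fun i => map φ (f i)) k (map φ h) := by
  funext i
  by_cases hi : i = k
  · subst hi
    simp
  · simp [hi]

/-- The resultant along a line in the space of forms `k` is a polynomial function. -/
noncomputable def resLine (d : Fin 3 → ℕ) (f : Fin 3 → MvPolynomial (Fin 3) S) (k : Fin 3)
    (h : MvPolynomial (Fin 3) S) : Polynomial S :=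
  res d (Function.update (fun i => map Polynomial.C (f i)) k
    (map Polynomial.C (f k) + C Polynomial.X * map Polynomial.C h))

theorem eval_resLine (f : Fin 3 → MvPolynomial (Fin 3) S) (k : Fin 3)
    (h : MvPolynomial (Fin 3) S) (t : S) :
    (resLine d f k h).eval t = res d (Function.update f k (f k + C t * h)) := by
  rw [resLine, ← Polynomial.coe_evalRingHom, map_res, map_update]
  simp [map_map, evalRingHom_comp_C, MvPolynomial.map_id]

/-- The degree of the resultant along a line is bounded by its degree of homogeneity. -/
theorem natDegree_resLine_le {j : ℕ} {k : Fin 3}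
    (hj : ∀ (c : ℂ) (f : Fin 3 → MvPolynomial (Fin 3) ℂ), (∀ i, (f i).IsHomogeneous (d i)) →
      res d (scaleAt k c f) = c ^ j * res d f)
    {f : Fin 3 → MvPolynomial (Fin 3) ℂ} (hf : ∀ i, (f i).IsHomogeneous (d i))
    {h : MvPolynomial (Fin 3) ℂ} (hh : h.IsHomogeneous (d k)) :
    (resLine d f k h).natDegree ≤ j := by
  by_contra! hlt
  set q := resLine d f k h with hq
  -- Homogeneity applied to `h + t f = t (f + t⁻¹ h)` expresses the reversed polynomial. If the
  -- degree exceeded `j`, the factor `t ^ (q.natDegree - j)` would make it vanish at 0, where its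
  -- value is the leading coefficient of `q`.
  have key : ∀ t : ℂ, t ≠ 0 → q.reverse.eval t =
      (Polynomial.X ^ (q.natDegree - j) * resLine d (Function.update f k h) k (f k)).eval t := by
    intro t ht
    let := invertibleOfNonzero ht
    let : Invertible t⁻¹ := invertibleOfNonzero (inv_ne_zero ht)
    have h1 := Polynomial.eval₂_reverse_mul_pow (RingHom.id ℂ) t⁻¹ q
    simp only [invOf_eq_inv, inv_inv, Polynomial.eval₂_id] at h1
    have h2 : Function.update (Function.update f k h) k
        (Function.update f k h k + C t * f k) =
        scaleAt k t (Function.update f k (f k + C t⁻¹ * h)) := by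
      funext i
      by_cases hi : i = k
      · subst hi
        simp [scaleAt, mul_add, ← mul_assoc, ← C_mul, mul_inv_cancel₀ ht, add_comm]
      · simp [scaleAt, hi]
    rw [Polynomial.eval_mul, Polynomial.eval_pow, Polynomial.eval_X, eval_resLine, h2,
      hj _ _ (isHomogeneous_update hf ((hf k).add (hh.C_mul _))), ← eval_resLine, ← hq, ← h1,
      ← mul_assoc, ← pow_add, Nat.sub_add_cancel hlt.le, mul_comm, mul_assoc, ← mul_pow,
      inv_mul_cancel₀ ht, one_pow, mul_one]
  have heq := Polynomial.eq_of_infinite_eval_eq _ _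
    ((Set.finite_singleton (0 : ℂ)).infinite_compl.mono key)
  have h0 := congrArg (Polynomial.eval 0) heq
  rw [Polynomial.eval_mul, Polynomial.eval_pow, Polynomial.eval_X,
    zero_pow (Nat.sub_ne_zero_of_lt hlt), zero_mul, ← Polynomial.coeff_zero_eq_eval_zero,
    Polynomial.coeff_zero_reverse, Polynomial.leadingCoeff_eq_zero] at h0
  rw [h0] at hlt
  simp at hlt

theorem eval_smul_of_isHomogeneous {n : ℕ} {f : MvPolynomial (Fin 3) S} (hf : f.IsHomogeneous n)
    (a : S) (z : Fin 3 → S) : eval (fun i => a * z i) f = a ^ n * eval z f := by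
  rw [eval_eq_sum_exponents hf, eval_eq_sum_exponents hf, Finset.mul_sum]
  refine Finset.sum_congr rfl fun u _ => ?_
  have : ∏ i, (a * z i) ^ u.1 i = a ^ n * ∏ i, z i ^ u.1 i := by
    simp_rw [mul_pow]
    rw [Finset.prod_mul_distrib, Finset.prod_pow_eq_pow_sum, ← Finsupp.degree_eq_sum, u.2]
  rw [this, mul_assoc]

/-! ### A model system with the maximal number of distinct common zeros. -/

/-- The forms `xᵢ ^ dᵢ - xₖ ^ dᵢ`. -/
noncomputable def unityForms (d : Fin 3 → ℕ) (k i : Fin 3) : MvPolynomial (Fin 3) ℂ :=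
  X i ^ d i - X k ^ d i

/-- The normalized common zeros of the forms `xᵢ ^ dᵢ - xₖ ^ dᵢ`. -/
noncomputable def unityPoints (d : Fin 3 → ℕ) (k : Fin 3) : Finset (Fin 3 → ℂ) :=
  Fintype.piFinset fun i => if i = k then {1} else Polynomial.nthRootsFinset (d i) (1 : ℂ)

theorem isHomogeneous_unityForms (d : Fin 3 → ℕ) (k i : Fin 3) :
    (unityForms d k i).IsHomogeneous (d i) :=
  (isHomogeneous_X_pow _ _).sub (isHomogeneous_X_pow _ _)

theorem mem_unityPoints (hd : ∀ i, 0 < d i) {k : Fin 3} {z : Fin 3 → ℂ} :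
    z ∈ unityPoints d k ↔ z k = 1 ∧ ∀ i, i ≠ k → z i ^ d i = 1 := by
  rw [unityPoints, Fintype.mem_piFinset]
  refine ⟨fun h => ⟨by simpa using h k, fun i hi => ?_⟩, fun h i => ?_⟩
  · simpa [hi, Polynomial.mem_nthRootsFinset (hd i)] using h i
  · by_cases hi : i = k
    · simp [hi, h.1]
    · simpa [hi, Polynomial.mem_nthRootsFinset (hd i)] using h.2 i hi

theorem card_unityPoints (hd : ∀ i, 0 < d i) (k : Fin 3) :
    (unityPoints d k).card = blockDegree d k := by
  rw [unityPoints, Fintype.card_piFinset, blockDegree]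
  refine Finset.prod_congr rfl fun i _ => ?_
  split_ifs
  · simp
  · exact (Complex.isPrimitiveRoot_exp _ (hd i).ne').card_nthRootsFinset

theorem eval_unityForms_of_mem (hd : ∀ i, 0 < d i) {k : Fin 3} {z : Fin 3 → ℂ}
    (hz : z ∈ unityPoints d k) (i : Fin 3) : eval z (unityForms d k i) = 0 := by
  rw [mem_unityPoints hd] at hz
  by_cases hi : i = k
  · simp [unityForms, hi]
  · simp [unityForms, hz.1, hz.2 i hi]

theorem exists_mem_unityPoints (hd : ∀ i, 0 < d i) {k : Fin 3} {z : Fin 3 → ℂ} (hz : z ≠ 0)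
    (h : ∀ i, i ≠ k → eval z (unityForms d k i) = 0) :
    ∃ a : ℂ, a ≠ 0 ∧ ∃ w ∈ unityPoints d k, z = fun i => a * w i := by
  have h' : ∀ i, i ≠ k → z i ^ d i = z k ^ d i := fun i hi => by
    simpa [unityForms, sub_eq_zero] using h i hi
  have hk : z k ≠ 0 := fun hk => hz (funext fun i => by
    by_cases hi : i = k
    · simp [hi, hk]
    · have := h' i hi
      rw [hk, zero_pow (hd i).ne'] at this
      simpa using pow_eq_zero_iff (hd i).ne' |>.mp this)
  refine ⟨z k, hk, fun i => z i / z k, (mem_unityPoints hd).mpr ⟨div_self hk, fun i hi => ?_⟩, ?_⟩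
  · rw [div_pow, h' i hi, div_self (pow_ne_zero _ hk)]
  · funext i
    rw [mul_div_cancel₀ _ hk]

/-- Along the line `h + t * xₖ ^ dₖ` the resultant with the forms `xᵢ ^ dᵢ - xₖ ^ dᵢ` vanishes
exactly when minus `t` is the value of `h` at one of their normalized common zeros. -/
theorem eval_resLine_unityForms_eq_zero_iff (hd : ∀ i, 0 < d i) (k : Fin 3)
    {h : MvPolynomial (Fin 3) ℂ} (hh : h.IsHomogeneous (d k)) (t : ℂ) :
    (resLine d (Function.update (unityForms d k) k h) k (X k ^ d k)).eval t = 0 ↔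
      ∃ w ∈ unityPoints d k, t = -eval w h := by
  have hf := isHomogeneous_update (isHomogeneous_unityForms d k) hh
  rw [eval_resLine, res_eq_zero_iff hd
    (isHomogeneous_update hf ((hf k).add ((isHomogeneous_X_pow _ _).C_mul _)))]
  rw [Function.update_idem, Function.update_self]
  constructor
  · rintro ⟨z, hz, hzf⟩
    obtain ⟨a, ha, w, hw, rfl⟩ := exists_mem_unityPoints hd hz fun i hi => by
      have := hzf i
      rwa [Function.update_of_ne hi] at this
    refine ⟨w, hw, ?_⟩
    have hk := hzf k
    rw [Function.update_self, eval_smul_of_isHomogeneous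
      (hh.add ((isHomogeneous_X_pow _ _).C_mul _))] at hk
    have hk' := (mul_eq_zero.mp hk).resolve_left (pow_ne_zero _ ha)
    simp only [map_add, map_mul, eval_C, map_pow, eval_X, ((mem_unityPoints hd).mp hw).1, one_pow,
      mul_one] at hk'
    linear_combination hk'
  · rintro ⟨w, hw, rfl⟩
    refine ⟨w, Function.ne_iff.mpr ⟨k, by simp [((mem_unityPoints hd).mp hw).1]⟩, fun i => ?_⟩
    by_cases hi : i = k
    · subst hi
      simp [((mem_unityPoints hd).mp hw).1]
    · simpa [hi] using eval_unityForms_of_mem hd hw i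

theorem resLine_unityForms_ne_zero (hd : ∀ i, 0 < d i) (k : Fin 3)
    {h : MvPolynomial (Fin 3) ℂ} (hh : h.IsHomogeneous (d k)) :
    resLine d (Function.update (unityForms d k) k h) k (X k ^ d k) ≠ 0 := by
  classical
  intro h0
  obtain ⟨t, ht⟩ := Infinite.exists_notMem_finset ((unityPoints d k).image fun w => -eval w h)
  refine ht ?_
  obtain ⟨w, hw, rfl⟩ := (eval_resLine_unityForms_eq_zero_iff hd k hh t).mp (by rw [h0]; simp)
  exact Finset.mem_image_of_mem _ hw

theorem blockDegree_le_card_roots (hd : ∀ i, 0 < d i) (k : Fin 3)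
    {h : MvPolynomial (Fin 3) ℂ} (hh : h.IsHomogeneous (d k))
    (hinj : Set.InjOn (fun w => eval w h) (unityPoints d k)) :
    blockDegree d k ≤
      (resLine d (Function.update (unityForms d k) k h) k (X k ^ d k)).roots.toFinset.card := by
  classical
  rw [← card_unityPoints hd k]
  refine Finset.card_le_card_of_injOn (fun w => -eval w h) (fun w hw => ?_)
    fun w hw w' hw' he => hinj hw hw' (neg_injective he)
  rw [Finset.mem_coe, Multiset.mem_toFinset, Polynomial.mem_roots (resLine_unityForms_ne_zero hd k hh)]
  exact (eval_resLine_unityForms_eq_zero_iff hd k hh _).mpr ⟨w, hw, rfl⟩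

/-- Some linear functional is nonzero on any finite list of nonzero vectors; here these are the unit
vectors and the differences of distinct points. -/
theorem exists_injOn_linear (Z : Finset (Fin 3 → ℂ)) : ∃ s : Fin 3 → ℂ, (∀ i, s i ≠ 0) ∧
    Set.InjOn (fun z => ∑ i, s i * z i) (Z : Set (Fin 3 → ℂ)) := by
  classical
  let v : Fin 3 ⊕ {p : Z × Z // p.1 ≠ p.2} → Fin 3 → ℂ :=
    Sum.elim (fun i => Pi.single i 1) fun p => p.1.1.1 - p.1.2.1
  obtain ⟨f, hf⟩ := Module.exists_dual_forall_apply_ne_zero (K := ℂ) v (by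
    rintro (i | ⟨p, hp⟩)
    · simp [v]
    · exact sub_ne_zero.mpr fun he => hp (Subtype.ext he))
  have hsum : ∀ z, f z = ∑ i, f (Pi.single i 1) * z i := fun z => by
    rw [LinearMap.pi_apply_eq_sum_univ f z]
    refine Finset.sum_congr rfl fun i _ => ?_
    rw [smul_eq_mul, mul_comm]
    congr 2
    funext j
    rcases eq_or_ne i j with rfl | hij
    · simp
    · simp [hij, hij.symm]
  refine ⟨fun i => f (Pi.single i 1), fun i => hf (.inl i), fun z hz w hw he => ?_⟩
  by_contra hne
  refine hf (.inr ⟨(⟨z, hz⟩, ⟨w, hw⟩), by simpa using hne⟩) ?_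
  simp only [v, Sum.elim_inr, map_sub, hsum z, hsum w]
  exact sub_eq_zero.mpr he

/-- The resultant is homogeneous of degree `blockDegree d k` in the coefficients of the form `k`. -/
theorem res_scaleAt {S : Type} [CommRing S] (hd : ∀ i, 0 < d i) (k : Fin 3) (c : S)
    {f : Fin 3 → MvPolynomial (Fin 3) S} (hf : ∀ i, (f i).IsHomogeneous (d i)) :
    res d (scaleAt k c f) = c ^ blockDegree d k * res d f := by
  obtain ⟨j, hj, hscale⟩ := exists_res_scaleAt hd k
  obtain ⟨s, -, hs⟩ := exists_injOn_linear (unityPoints d k)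
  -- At the normalized zeros `x_k = 1`, so `h` takes the values of the separating linear form. The
  -- number of distinct roots of the resultant on the line then squeezes the unknown degree `j`
  -- between `blockDegree d k` and itself.
  let h : MvPolynomial (Fin 3) ℂ := (∑ i, C (s i) * X i) * X k ^ (d k - 1)
  have hh : h.IsHomogeneous (d k) := by
    have := (isHomogeneous_linearForm s).mul (isHomogeneous_X_pow (R := ℂ) k (d k - 1))
    rwa [Nat.add_sub_cancel' (hd k)] at this
  have h1 := blockDegree_le_card_roots hd k hh fun w hw w' hw' he => hs hw hw' (by
    simpa [h, ((mem_unityPoints hd).mp hw).1, ((mem_unityPoints hd).mp hw').1] using he)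
  have h2 := natDegree_resLine_le (fun c f hf => hscale c f hf)
    (isHomogeneous_update (isHomogeneous_unityForms d k) hh) (isHomogeneous_X_pow k (d k))
  have h3 := (Multiset.toFinset_card_le _).trans (Polynomial.card_roots'
    (resLine d (Function.update (unityForms d k) k h) k (X k ^ d k)))
  rw [hscale c f hf, le_antisymm hj (h1.trans (h3.trans h2))]

/-- There are at least as many distinct roots as the degree bound allows, so all roots are simple.
-/
theorem nodup_roots_resLine_unityForms (hd : ∀ i, 0 < d i) (k : Fin 3)
    {h : MvPolynomial (Fin 3) ℂ} (hh : h.IsHomogeneous (d k))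
    (hinj : Set.InjOn (fun w => eval w h) (unityPoints d k)) :
    (resLine d (Function.update (unityForms d k) k h) k (X k ^ d k)).roots.Nodup := by
  classical
  have h1 := blockDegree_le_card_roots hd k hh hinj
  have h2 := natDegree_resLine_le (fun c f hf => res_scaleAt hd k c hf)
    (isHomogeneous_update (isHomogeneous_unityForms d k) hh) (isHomogeneous_X_pow k (d k))
  rw [← Multiset.toFinset_card_eq_card_iff_nodup]
  exact le_antisymm (Multiset.toFinset_card_le _) ((Polynomial.card_roots' _).trans (h2.trans h1))

/-! ### Invariance under addition of multiples of the other forms -/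

/-- Replacing `f k` by `f k + t H` does not change the common zeros. Hence the resultant, a
polynomial in `t`, vanishes for all `t` or for none, and in the latter case it is constant. -/
theorem res_update_add_of_isAlgClosed {K : Type*} [Field K] [IsAlgClosed K] (hd : ∀ i, 0 < d i)
    {f : Fin 3 → MvPolynomial (Fin 3) K} (hf : ∀ i, (f i).IsHomogeneous (d i)) (k : Fin 3)
    {H : MvPolynomial (Fin 3) K} (hH : H.IsHomogeneous (d k))
    (h : ∀ z, (∀ i, i ≠ k → eval z (f i) = 0) → eval z H = 0) :
    res d (Function.update f k (f k + H)) = res d f := by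
  have hzero : ∀ t : K, HasCommonZero (Function.update f k (f k + C t * H)) ↔ HasCommonZero f := by
    intro t
    refine exists_congr fun z => and_congr_right fun _ => ?_
    have hiff : (∀ i, i ≠ k → eval z (f i) = 0) →
        (eval z (f k + C t * H) = 0 ↔ eval z (f k) = 0) := fun hz => by
      simp [h z hz]
    constructor
    · intro hz
      have hz' : ∀ i, i ≠ k → eval z (f i) = 0 := fun i hi => by simpa [hi] using hz i
      intro i
      by_cases hi : i = k
      · subst hi
        exact (hiff hz').mp (by simpa using hz i)
      · exact hz' i hi
    · intro hz i
      by_cases hi : i = k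
      · subst hi
        simpa using (hiff fun i _ => hz i).mpr (hz i)
      · simpa [hi] using hz i
  have hhom : ∀ t : K, ∀ i, (Function.update f k (f k + C t * H) i).IsHomogeneous (d i) :=
    fun t => isHomogeneous_update hf ((hf k).add (hH.C_mul t))
  have hev : ∀ t, (resLine d f k H).eval t = 0 ↔ res d f = 0 := fun t => by
    rw [eval_resLine, res_eq_zero_iff hd (hhom t), hzero, res_eq_zero_iff hd hf]
  have h0 : (resLine d f k H).eval 0 = res d f := by
    rw [eval_resLine]
    simp
  have h1 : (resLine d f k H).eval 1 = res d (Function.update f k (f k + H)) := by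
    rw [eval_resLine]
    simp
  rw [← h1]
  by_cases hr : res d f = 0
  · rw [hr]
    exact (hev 1).mpr hr
  · have hdeg : (resLine d f k H).degree = 0 := by
      by_contra hne
      obtain ⟨t, ht⟩ := IsAlgClosed.exists_root _ hne
      exact hr ((hev t).mp ht)
    rw [Polynomial.eq_C_of_degree_eq_zero hdeg] at h0 ⊢
    rw [← h0, Polynomial.eval_C, Polynomial.eval_C]

theorem res_update_add [IsDomain S] (hd : ∀ i, 0 < d i)
    {f : Fin 3 → MvPolynomial (Fin 3) S} (hf : ∀ i, (f i).IsHomogeneous (d i)) (k : Fin 3)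
    {H : MvPolynomial (Fin 3) S} (hH : H.IsHomogeneous (d k)) (h : Fin 3 → MvPolynomial (Fin 3) S)
    (hsum : H = ∑ i ∈ Finset.univ.erase k, h i * f i) :
    res d (Function.update f k (f k + H)) = res d f := by
  let φ : S →+* AlgebraicClosure (FractionRing S) :=
    (algebraMap (FractionRing S) _).comp (algebraMap S (FractionRing S))
  have hφ : Function.Injective φ :=
    (algebraMap (FractionRing S) _).injective.comp (IsFractionRing.injective S (FractionRing S))
  apply hφ
  rw [map_res, map_res, map_update, map_add]
  refine res_update_add_of_isAlgClosed hd (fun i => (hf i).map φ) k (hH.map φ) fun z hz => ?_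
  rw [hsum, map_sum, map_sum]
  exact Finset.sum_eq_zero fun i hi => by
    rw [map_mul, map_mul, hz i (Finset.ne_of_mem_erase hi), mul_zero]

/-! ### Multiplicativity of the resultant -/

theorem prime_rename_of_injective {σ τ : Type*} {ι : σ → τ} (hι : Function.Injective ι)
    {P : MvPolynomial σ ℤ} (hP : Prime P) : Prime (rename ι P) := by
  let ε := Equiv.ofInjective ι hι
  have h1 : Prime (rename ε P) :=
    (MulEquiv.prime_iff (renameEquiv ℤ ε).toMulEquiv).mpr hP
  have h2 := (prime_rename_iff (Set.range ι)).mpr h1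
  rwa [rename_rename] at h2

theorem subst_X_comp {σ τ : Type*} (ι : σ → τ) (P : MvPolynomial σ ℤ) :
    subst (fun v => (X (ι v) : MvPolynomial τ ℤ)) P = rename ι P := by
  rw [← subst_rename, subst_X_left]

theorem res_C_mul {S : Type} [CommRing S] (hd : ∀ i, 0 < d i) (c : Fin 3 → S)
    {f : Fin 3 → MvPolynomial (Fin 3) S} (hf : ∀ i, (f i).IsHomogeneous (d i)) :
    res d (fun i => C (c i) * f i) = (∏ i, c i ^ blockDegree d i) * res d f := by
  have h2 := isHomogeneous_scaleAt 2 (c 2) hf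
  have h1 := isHomogeneous_scaleAt 1 (c 1) h2
  have : (fun i => C (c i) * f i) = scaleAt 0 (c 0) (scaleAt 1 (c 1) (scaleAt 2 (c 2) f)) := by
    funext i
    fin_cases i <;> simp [scaleAt]
  rw [this, res_scaleAt hd 0 _ h1, res_scaleAt hd 1 _ h2, res_scaleAt hd 2 _ hf,
    Fin.prod_univ_three]
  ring

section Mul

variable {e D : Fin 3 → ℕ} {k : Fin 3}

theorem blockDegree_self (he : ∀ i, i ≠ k → e i = d i) : blockDegree e k = blockDegree d k := by
  refine Finset.prod_congr rfl fun i _ => ?_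
  split_ifs with hi
  · rfl
  · exact he i hi

theorem blockDegree_add (he : ∀ i, i ≠ k → e i = d i) (hD : ∀ i, i ≠ k → D i = d i)
    (hDk : D k = d k + e k) {i : Fin 3} (hi : i ≠ k) :
    blockDegree D i = blockDegree d i + blockDegree e i := by
  have h : ∀ f : Fin 3 → ℕ, blockDegree f i =
      f k * ∏ j ∈ Finset.univ.erase k, if j = i then 1 else f j := fun f => by
    rw [blockDegree, ← Finset.mul_prod_erase _ _ (Finset.mem_univ k), if_neg hi.symm]
  have h' : ∀ f : Fin 3 → ℕ, (∀ i, i ≠ k → f i = d i) →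
      (∏ j ∈ Finset.univ.erase k, if j = i then 1 else f j) =
        ∏ j ∈ Finset.univ.erase k, if j = i then 1 else d j := fun f hf =>
    Finset.prod_congr rfl fun j hj => by rw [hf j (Finset.ne_of_mem_erase hj)]
  rw [h, h d, h e, h' D hD, h' e he, hDk, add_mul]

/-- Embedding of the coefficients of a triple in those of a triple and a further form replacing
the form `k`. -/
noncomputable def replaceIndex (he : ∀ i, i ≠ k → e i = d i) (v : CoeffIndex e) :
    CoeffIndex d ⊕ Exponents (e k) :=
  if h : v.1 = k then .inr ⟨v.2.1, by rw [v.2.2, h]⟩ else .inl ⟨v.1, v.2.1, by rw [v.2.2, he _ h]⟩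

theorem replaceIndex_injective (he : ∀ i, i ≠ k → e i = d i) :
    Function.Injective (replaceIndex he) := by
  rintro ⟨i, u, hu⟩ ⟨j, w, hw⟩ h
  by_cases hi : i = k <;> by_cases hj : j = k
  · subst hi
    subst hj
    simpa [replaceIndex] using h
  · simp [replaceIndex, hi, hj] at h
  · simp [replaceIndex, hi, hj] at h
  · simp only [replaceIndex, hi, hj, dite_false, Sum.inl.injEq, Sigma.mk.injEq] at h
    obtain ⟨rfl, h⟩ := h
    simpa using h

theorem isHomogeneous_update_of_eq (he : ∀ i, i ≠ k → e i = d i)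
    {f : Fin 3 → MvPolynomial (Fin 3) S} (hf : ∀ i, (f i).IsHomogeneous (d i))
    {g : MvPolynomial (Fin 3) S} (hg : g.IsHomogeneous (e k)) (i : Fin 3) :
    (Function.update f k g i).IsHomogeneous (e i) := by
  by_cases hi : i = k
  · subst hi
    simpa using hg
  · rw [Function.update_of_ne hi, he i hi]
    exact hf i

/-- The coefficients of a triple of forms and a further form. -/
noncomputable def pairCoeffs (d : Fin 3 → ℕ) (n : ℕ) (f : Fin 3 → MvPolynomial (Fin 3) S)
    (g : MvPolynomial (Fin 3) S) : CoeffIndex d ⊕ Exponents n → S :=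
  Sum.elim (fun v => (f v.1).coeff v.2.1) fun u => g.coeff u.1

/-- The generic triple of forms over the ring of coefficients of a triple and a further form. -/
noncomputable def pairForms (d : Fin 3 → ℕ) (n : ℕ) (i : Fin 3) :
    MvPolynomial (Fin 3) (MvPolynomial (CoeffIndex d ⊕ Exponents n) ℤ) :=
  ofCoeffs fun u : Exponents (d i) => X (.inl ⟨i, u⟩)

/-- The generic further form over the ring of coefficients of a triple and a further form. -/
noncomputable def pairExtra (d : Fin 3 → ℕ) (n : ℕ) :
    MvPolynomial (Fin 3) (MvPolynomial (CoeffIndex d ⊕ Exponents n) ℤ) :=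
  ofCoeffs fun u : Exponents n => X (.inr u)

theorem map_pairForms (n : ℕ) {f : Fin 3 → MvPolynomial (Fin 3) S}
    (hf : ∀ i, (f i).IsHomogeneous (d i)) (g : MvPolynomial (Fin 3) S) (i : Fin 3) :
    map (subst (pairCoeffs d n f g)) (pairForms d n i) = f i := by
  simpa [pairForms, map_ofCoeffs, pairCoeffs] using ofCoeffs_coeff (hf i)

theorem map_pairExtra {n : ℕ} (f : Fin 3 → MvPolynomial (Fin 3) S) {g : MvPolynomial (Fin 3) S}
    (hg : g.IsHomogeneous n) : map (subst (pairCoeffs d n f g)) (pairExtra d n) = g := by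
  simpa [pairExtra, map_ofCoeffs, pairCoeffs] using ofCoeffs_coeff hg

theorem exists_pairCoeffs_eq {n : ℕ} (c : CoeffIndex d ⊕ Exponents n → S) :
    ∃ (f : Fin 3 → MvPolynomial (Fin 3) S) (g : MvPolynomial (Fin 3) S),
      (∀ i, (f i).IsHomogeneous (d i)) ∧ g.IsHomogeneous n ∧ pairCoeffs d n f g = c := by
  refine ⟨fun i => ofCoeffs fun u : Exponents (d i) => c (.inl ⟨i, u⟩), ofCoeffs fun u => c (.inr u),
    fun i => isHomogeneous_ofCoeffs _, isHomogeneous_ofCoeffs _, funext fun v => ?_⟩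
  rcases v with ⟨i, u⟩ | u
  · exact coeff_ofCoeffs (fun u : Exponents (d i) => c (.inl ⟨i, u⟩)) u
  · exact coeff_ofCoeffs (fun u : Exponents n => c (.inr u)) u

theorem subst_res_pairForms {n : ℕ} {f : Fin 3 → MvPolynomial (Fin 3) S}
    (hf : ∀ i, (f i).IsHomogeneous (d i)) (g : MvPolynomial (Fin 3) S) :
    subst (pairCoeffs d n f g) (res d (pairForms d n)) = res d f := by
  simp only [map_res, map_pairForms n hf]

theorem subst_res_pairExtra {n : ℕ} {f : Fin 3 → MvPolynomial (Fin 3) S}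
    (hf : ∀ i, (f i).IsHomogeneous (d i)) {g : MvPolynomial (Fin 3) S} (hg : g.IsHomogeneous n) :
    subst (pairCoeffs d n f g) (res e (Function.update (pairForms d n) k (pairExtra d n))) =
      res e (Function.update f k g) := by
  simp only [map_res, map_update, map_pairForms n hf, map_pairExtra f hg]

theorem subst_res_pairMul {n : ℕ} {f : Fin 3 → MvPolynomial (Fin 3) S}
    (hf : ∀ i, (f i).IsHomogeneous (d i)) {g : MvPolynomial (Fin 3) S} (hg : g.IsHomogeneous n) :
    subst (pairCoeffs d n f g)
      (res D (Function.update (pairForms d n) k (pairForms d n k * pairExtra d n))) =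
      res D (Function.update f k (f k * g)) := by
  simp only [map_res, map_update, map_mul, map_pairForms n hf, map_pairExtra f hg]

theorem prime_res_pairForms (hd : ∀ i, 0 < d i) (n : ℕ) : Prime (res d (pairForms d n)) := by
  have : res d (pairForms d n) = rename Sum.inl (resultant d) := by
    rw [← subst_X_comp]
    exact congrArg (fun c => subst c (resultant d)) (funext fun v => coeff_ofCoeffs _ v.2)
  rw [this]
  exact prime_rename_of_injective Sum.inl_injective (resultant_spec hd).1

theorem prime_res_pairExtra (hepos : ∀ i, 0 < e i) (he : ∀ i, i ≠ k → e i = d i) :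
    Prime (res e (Function.update (pairForms d (e k)) k (pairExtra d (e k)))) := by
  have : res e (Function.update (pairForms d (e k)) k (pairExtra d (e k))) =
      rename (replaceIndex he) (resultant e) := by
    rw [← subst_X_comp]
    refine congrArg (fun c => subst c (resultant e)) (funext fun v => ?_)
    obtain ⟨i, u, hu⟩ := v
    by_cases hi : i = k
    · subst hi
      simp only [Function.update_self, replaceIndex, dite_true]
      exact coeff_ofCoeffs _ (⟨u, hu⟩ : Exponents (e i))
    · simp only [Function.update_of_ne hi, replaceIndex, hi, dite_false]
      exact coeff_ofCoeffs _ (⟨u, hu.trans (he i hi)⟩ : Exponents (d i))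
  rw [this]
  exact prime_rename_of_injective (replaceIndex_injective he) (resultant_spec hepos).1

theorem update_X_pow_eq (he : ∀ i, i ≠ k → e i = d i) :
    Function.update (fun i => (X i ^ d i : MvPolynomial (Fin 3) S)) k (X k ^ e k) =
      fun i => X i ^ e i := by
  funext i
  by_cases hi : i = k
  · subst hi
    simp
  · simp [hi, he i hi]

theorem hasCommonZero_zero [Nontrivial S] :
    HasCommonZero (fun _ => 0 : Fin 3 → MvPolynomial (Fin 3) S) :=
  ⟨1, one_ne_zero, fun _ => map_zero _⟩

/-- The two resultants divide that of the product. -/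
theorem exists_res_pairMul_eq (hd : ∀ i, 0 < d i) (hepos : ∀ i, 0 < e i) (hDpos : ∀ i, 0 < D i)
    (he : ∀ i, i ≠ k → e i = d i) (hD : ∀ i, i ≠ k → D i = d i) (hDk : D k = d k + e k) :
    ∃ E, res D (Function.update (pairForms d (e k)) k (pairForms d (e k) k * pairExtra d (e k))) =
      res d (pairForms d (e k)) *
        res e (Function.update (pairForms d (e k)) k (pairExtra d (e k))) * E := by
  have hhom : ∀ {f : Fin 3 → MvPolynomial (Fin 3) ℂ} {g : MvPolynomial (Fin 3) ℂ},
      (∀ i, (f i).IsHomogeneous (d i)) → g.IsHomogeneous (e k) →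
      ∀ i, (Function.update f k (f k * g) i).IsHomogeneous (D i) := fun hf hg =>
    isHomogeneous_update_of_eq hD hf (by rw [hDk]; exact (hf k).mul hg)
  have h0 : ∀ i : Fin 3, (0 : MvPolynomial (Fin 3) ℂ).IsHomogeneous (d i) :=
    fun i => isHomogeneous_zero _ _ _
  have h0' : (0 : MvPolynomial (Fin 3) ℂ).IsHomogeneous (e k) := isHomogeneous_zero _ _ _
  obtain ⟨E₁, hE₁⟩ : res d (pairForms d (e k)) ∣
      res D (Function.update (pairForms d (e k)) k (pairForms d (e k) k * pairExtra d (e k))) := by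
    refine dvd_of_forall_subst_eq_zero (prime_res_pairForms hd _)
      ((subst_res_pairForms h0 0).trans (res_eq_zero_of_hasCommonZero hd h0 hasCommonZero_zero))
      fun c hc => ?_
    obtain ⟨f, g, hf, hg, rfl⟩ := exists_pairCoeffs_eq c
    rw [subst_res_pairForms hf, res_eq_zero_iff hd hf] at hc
    rw [subst_res_pairMul hf hg, res_eq_zero_iff hDpos (hhom hf hg)]
    obtain ⟨z, hz, hzf⟩ := hc
    refine ⟨z, hz, fun i => ?_⟩
    by_cases hi : i = k
    · subst hi
      simp [hzf i]
    · simpa [hi] using hzf i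
  have hdvd : res e (Function.update (pairForms d (e k)) k (pairExtra d (e k))) ∣
      res D (Function.update (pairForms d (e k)) k (pairForms d (e k) k * pairExtra d (e k))) := by
    refine dvd_of_forall_subst_eq_zero (prime_res_pairExtra hepos he)
      ((subst_res_pairExtra h0 h0').trans (res_eq_zero_of_hasCommonZero hepos
        (isHomogeneous_update_of_eq he h0 h0') (by
          rw [Function.update_eq_self k (fun _ => (0 : MvPolynomial (Fin 3) ℂ))]
          exact hasCommonZero_zero))) fun c hc => ?_
    obtain ⟨f, g, hf, hg, rfl⟩ := exists_pairCoeffs_eq c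
    rw [subst_res_pairExtra hf hg, res_eq_zero_iff hepos (isHomogeneous_update_of_eq he hf hg)] at hc
    rw [subst_res_pairMul hf hg, res_eq_zero_iff hDpos (hhom hf hg)]
    obtain ⟨z, hz, hzf⟩ := hc
    refine ⟨z, hz, fun i => ?_⟩
    have hi' := hzf i
    by_cases hi : i = k
    · subst hi
      rw [Function.update_self] at hi' ⊢
      rw [map_mul, hi', mul_zero]
    · rw [Function.update_of_ne hi] at hi' ⊢
      exact hi'
  rw [hE₁] at hdvd
  -- The second prime does not divide the first: at `f = (x_i ^ d_i)` and `g = 0` the first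
  -- resultant is 1, while the other is 0 because the unit vector of index `k` is a common zero.
  rcases (prime_res_pairExtra hepos he).dvd_or_dvd hdvd with h | ⟨E, hE⟩
  · exfalso
    obtain ⟨E, hE⟩ := h
    have hX : ∀ i, (X i ^ d i : MvPolynomial (Fin 3) ℂ).IsHomogeneous (d i) :=
      fun i => isHomogeneous_X_pow _ _
    have := congrArg (subst (pairCoeffs d (e k) (fun i => X i ^ d i : Fin 3 →
      MvPolynomial (Fin 3) ℂ) 0)) hE
    rw [subst_res_pairForms hX, res_X_pow hd, map_mul, subst_res_pairExtra hX h0',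
      res_eq_zero_of_hasCommonZero hepos (isHomogeneous_update_of_eq he hX h0')
        ⟨Pi.single k 1, by simp, fun i => ?_⟩, zero_mul] at this
    · exact one_ne_zero this
    · by_cases hi : i = k
      · subst hi
        simp
      · simp [hi, (hd i).ne']
  · exact ⟨E, by rw [hE₁, hE, mul_assoc]⟩

theorem prod_pow_blockDegree (he : ∀ i, i ≠ k → e i = d i) (hD : ∀ i, i ≠ k → D i = d i)
    (hDk : D k = d k + e k) (t : S) :
    ∏ i, (if i = k then t * t else t) ^ blockDegree D i =
      (∏ i, t ^ blockDegree d i) * ∏ i, t ^ blockDegree e i := by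
  rw [← Finset.prod_mul_distrib]
  refine Finset.prod_congr rfl fun i _ => ?_
  split_ifs with hi
  · rw [hi, blockDegree_self hD, blockDegree_self he, mul_pow]
  · rw [blockDegree_add he hD hDk hi, pow_add]

/-- The resultant is multiplicative in each of the three forms. -/
theorem res_update_mul {S : Type} [CommRing S] (hd : ∀ i, 0 < d i) (hek : 0 < e k)
    (he : ∀ i, i ≠ k → e i = d i) (hD : ∀ i, i ≠ k → D i = d i) (hDk : D k = d k + e k)
    {f : Fin 3 → MvPolynomial (Fin 3) S} (hf : ∀ i, (f i).IsHomogeneous (d i))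
    {g : MvPolynomial (Fin 3) S} (hg : g.IsHomogeneous (e k)) :
    res D (Function.update f k (f k * g)) = res d f * res e (Function.update f k g) := by
  have hepos : ∀ i, 0 < e i := fun i => by
    by_cases hi : i = k
    · exact hi ▸ hek
    · exact he i hi ▸ hd i
  have hDpos : ∀ i, 0 < D i := fun i => by
    by_cases hi : i = k
    · rw [hi, hDk]
      exact Nat.add_pos_left (hd k) _
    · exact hD i hi ▸ hd i
  obtain ⟨E, hE⟩ := exists_res_pairMul_eq hd hepos hDpos he hD hDk
  have hval : ∀ {f : Fin 3 → MvPolynomial (Fin 3) ℂ} {g : MvPolynomial (Fin 3) ℂ},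
      (∀ i, (f i).IsHomogeneous (d i)) → g.IsHomogeneous (e k) →
      res D (Function.update f k (f k * g)) = res d f * res e (Function.update f k g) *
        subst (pairCoeffs d (e k) f g) E := fun {f g} hf hg => by
    have := congrArg (subst (pairCoeffs d (e k) f g)) hE
    rwa [subst_res_pairMul hf hg, map_mul, map_mul, subst_res_pairForms hf,
      subst_res_pairExtra hf hg] at this
  -- the cofactor is constant, by homogeneity
  have hconst : ∀ {f : Fin 3 → MvPolynomial (Fin 3) ℂ} {g : MvPolynomial (Fin 3) ℂ},
      (∀ i, (f i).IsHomogeneous (d i)) → g.IsHomogeneous (e k) →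
      res d f * res e (Function.update f k g) ≠ 0 →
      subst (pairCoeffs d (e k) f g) E = subst (fun _ => (0 : ℂ)) E := by
    intro f g hf hg hne
    -- This is the cofactor along the ray `t ↦ (t f, t g)`. Both sides of `hval` scale by the same
    -- power of `t` there, so it is constant for `t ≠ 0`, hence equal to its value at the origin.
    let γ : Polynomial ℂ :=
      subst (fun v => Polynomial.X * Polynomial.C (pairCoeffs d (e k) f g v)) E
    have hγ : ∀ t, γ.eval t = subst (fun v => t * pairCoeffs d (e k) f g v) E := fun t => by
      rw [← Polynomial.coe_evalRingHom, map_subst]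
      simp [mul_comm t]
    have hγ1 : ∀ t : ℂ, t ≠ 0 → γ.eval t = (Polynomial.C (γ.eval 1)).eval t := by
      intro t ht
      have hc : (fun v => t * pairCoeffs d (e k) f g v) =
          pairCoeffs d (e k) (fun i => C t * f i) (C t * g) := by
        funext v
        rcases v with v | u <;> simp [pairCoeffs]
      have h1 := hval (fun i => (hf i).C_mul t) (hg.C_mul t)
      have u1 : Function.update (fun i => C t * f i) k (C t * f k * (C t * g)) = fun i =>
          C (if i = k then t * t else t) * Function.update f k (f k * g) i := by
        funext i
        by_cases hi : i = k
        · subst hi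
          simp only [Function.update_self, if_true, C_mul]
          ring
        · simp [hi]
      have u2 : Function.update (fun i => C t * f i) k (C t * g) = fun i =>
          C t * Function.update f k g i := by
        funext i
        by_cases hi : i = k
        · subst hi
          simp
        · simp [hi]
      rw [u1, u2, res_C_mul hDpos _ (isHomogeneous_update_of_eq hD hf
          (by rw [hDk]; exact (hf k).mul hg)), res_C_mul hd _ hf,
        res_C_mul hepos _ (isHomogeneous_update_of_eq he hf hg), prod_pow_blockDegree he hD hDk,
        hval hf hg, ← hc, ← hγ] at h1
      have h2 : γ.eval 1 = subst (pairCoeffs d (e k) f g) E := by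
        rw [hγ]
        simp
      have hp : (∏ i, t ^ blockDegree d i) * ∏ i, t ^ blockDegree e i ≠ 0 :=
        mul_ne_zero (Finset.prod_ne_zero_iff.mpr fun i _ => pow_ne_zero _ ht)
          (Finset.prod_ne_zero_iff.mpr fun i _ => pow_ne_zero _ ht)
      rw [Polynomial.eval_C, h2]
      refine mul_left_cancel₀ (mul_ne_zero hp hne) ?_
      linear_combination -h1
    have heq := Polynomial.eq_of_infinite_eval_eq _ _
      ((Set.finite_singleton (0 : ℂ)).infinite_compl.mono hγ1)
    have h0 := hγ 0
    rw [heq, Polynomial.eval_C, hγ] at h0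
    simpa using h0
  have hE0 : subst (fun _ => (0 : ℂ)) E = 1 := by
    have hX : ∀ i, (X i ^ d i : MvPolynomial (Fin 3) ℂ).IsHomogeneous (d i) :=
      fun i => isHomogeneous_X_pow _ _
    have h1 := hval hX (isHomogeneous_X_pow k (e k))
    have h2 := hconst hX (isHomogeneous_X_pow k (e k))
    rw [← pow_add, ← hDk, update_X_pow_eq hD, update_X_pow_eq he, res_X_pow hd, res_X_pow hepos,
      res_X_pow hDpos, one_mul, one_mul] at h1
    rw [update_X_pow_eq he, res_X_pow hd, res_X_pow hepos, one_mul] at h2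
    rw [← h2 one_ne_zero, ← h1]
  suffices hmain : res D (Function.update (pairForms d (e k)) k
      (pairForms d (e k) k * pairExtra d (e k))) = res d (pairForms d (e k)) *
        res e (Function.update (pairForms d (e k)) k (pairExtra d (e k))) by
    rw [← subst_res_pairMul hf hg, hmain, map_mul, subst_res_pairForms hf,
      subst_res_pairExtra hf hg]
  rw [← sub_eq_zero]
  by_contra hne
  obtain ⟨c, hc⟩ := exists_subst_ne_zero hne
  obtain ⟨f, g, hf, hg, rfl⟩ := exists_pairCoeffs_eq c
  rw [map_sub, map_mul, subst_res_pairMul hf hg, subst_res_pairForms hf, subst_res_pairExtra hf hg,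
    hval hf hg] at hc
  -- Where the product vanishes, so does the left side, whatever the cofactor is.
  by_cases h0 : res d f * res e (Function.update f k g) = 0
  · rw [h0] at hc
    simp at hc
  · rw [hconst hf hg h0, hE0] at hc
    simp at hc

end Mul

/-! ### Primitive polynomials -/

/-- No prime number divides all coefficients. -/
def IsPrim {σ : Type*} (P : MvPolynomial σ ℤ) : Prop :=
  ∀ p : ℕ, p.Prime → ¬ (p : MvPolynomial σ ℤ) ∣ P

theorem prime_natCast {σ : Type*} {p : ℕ} (hp : p.Prime) : Prime (p : MvPolynomial σ ℤ) := by
  rw [← map_natCast (C : ℤ →+* MvPolynomial σ ℤ)]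
  exact (prime_C_iff σ).mpr (Nat.prime_iff_prime_int.mp hp)

theorem IsPrim.of_dvd {σ : Type*} {P Q : MvPolynomial σ ℤ} (hQ : IsPrim Q) (h : P ∣ Q) :
    IsPrim P := fun p hp hdvd => hQ p hp (hdvd.trans h)

theorem isPrim_X {σ : Type*} (v : σ) : IsPrim (X v : MvPolynomial σ ℤ) := fun p hp hdvd => by
  classical
  rw [← map_natCast (C : ℤ →+* MvPolynomial σ ℤ), C_dvd_iff_dvd_coeff] at hdvd
  have := hdvd (Finsupp.single v 1)
  simp only [coeff_X] at this
  exact (Nat.prime_iff_prime_int.mp hp).not_isUnit (isUnit_of_dvd_one this)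

/-- This is Gauss's lemma: prime numbers stay prime in the polynomial ring, and `N` is split off one
prime factor at a time. -/
theorem IsPrim.dvd_of_dvd_mul {σ : Type*} {P Q : MvPolynomial σ ℤ} (hQ : IsPrim Q) {N : ℕ}
    (hN : N ≠ 0) (h : (N : MvPolynomial σ ℤ) ∣ P * Q) : (N : MvPolynomial σ ℤ) ∣ P := by
  induction N using Nat.recOnMul generalizing P with
  | zero => exact absurd rfl hN
  | one => simp
  | prime p hp => exact ((prime_natCast hp).dvd_or_dvd h).resolve_right (hQ p hp)
  | mul a b iha ihb =>
    have ha : a ≠ 0 := left_ne_zero_of_mul hN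
    rw [Nat.cast_mul] at h ⊢
    obtain ⟨P', rfl⟩ := iha ha ((dvd_mul_right _ _).trans h)
    rw [mul_assoc] at h
    exact mul_dvd_mul_left _ (ihb (right_ne_zero_of_mul hN)
      ((mul_dvd_mul_iff_left (Nat.cast_ne_zero.mpr ha)).mp h))

theorem isPrim_of_forall_exists {σ : Type*} {P : MvPolynomial σ ℤ}
    (h : ∀ p : ℕ, p.Prime → ∃ (K : Type) (_ : CommRing K) (_ : CharP K p) (c : σ → K),
      subst c P ≠ 0) : IsPrim P := by
  rintro p hp ⟨Q, rfl⟩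
  obtain ⟨K, _, _, c, hc⟩ := h p hp
  rw [map_mul, map_natCast, CharP.cast_eq_zero, zero_mul] at hc
  exact hc rfl

theorem IsPrim.hasContentOne {σ : Type*} {P : MvPolynomial σ ℤ} (hP : IsPrim P) :
    HasContentOne P := by
  rw [HasContentOne, ← Finset.normalize_gcd, normalize_eq_one, Int.isUnit_iff_natAbs_eq]
  by_contra hne
  obtain ⟨p, hp, hdvd⟩ := Nat.exists_prime_and_dvd hne
  refine hP p hp ?_
  rw [← map_natCast (C : ℤ →+* MvPolynomial σ ℤ), C_dvd_iff_dvd_coeff]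
  intro m
  by_cases hm : m ∈ P.support
  · exact (Int.natCast_dvd.mpr hdvd).trans (Finset.gcd_dvd hm)
  · rw [notMem_support_iff.mp hm]
    exact dvd_zero _

/-! ### Resultants with coordinate lines -/

theorem eval_single_of_isHomogeneous {n : ℕ} {f : MvPolynomial (Fin 3) S} (hf : f.IsHomogeneous n)
    (i : Fin 3) (a : S) :
    eval (Pi.single i a) f = a ^ n * f.coeff (Finsupp.single i n) := by
  rw [eval_eq_sum_exponents hf, Finset.sum_eq_single (pureExponent i n)]
  · congr 1
    rw [Finset.prod_eq_single i]
    · simp [pureExponent]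
    · intro j _ hj
      simp [pureExponent, hj.symm]
    · simp
  · intro u _ hu
    obtain ⟨j, hj, huj⟩ : ∃ j, j ≠ i ∧ u.1 j ≠ 0 := by
      by_contra! h
      refine hu (Subtype.ext (Finsupp.ext fun j => ?_))
      by_cases hj : j = i
      · subst hj
        have := u.2
        rw [Finsupp.degree_eq_sum, Finset.sum_eq_single j (fun l _ hl => h l hl) (by simp)] at this
        simpa [pureExponent] using this
      · simp [pureExponent, Ne.symm hj, h j hj]
    rw [Finset.prod_eq_zero (Finset.mem_univ j) (by simp [hj, huj]), zero_mul]
  · simp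

/-- The generic ternary form of degree `n`. -/
noncomputable def genericForm (n : ℕ) : MvPolynomial (Fin 3) (MvPolynomial (Exponents n) ℤ) :=
  ofCoeffs X

theorem isHomogeneous_genericForm (n : ℕ) : (genericForm n).IsHomogeneous n :=
  isHomogeneous_ofCoeffs _

theorem map_genericForm {n : ℕ} {f : MvPolynomial (Fin 3) S} (hf : f.IsHomogeneous n) :
    map (subst (coeffs n f)) (genericForm n) = f := by
  rw [genericForm, map_ofCoeffs]
  simpa [coeffs] using ofCoeffs_coeff hf

theorem exists_coeffs_eq {n : ℕ} (c : Exponents n → S) :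
    ∃ f : MvPolynomial (Fin 3) S, f.IsHomogeneous n ∧ coeffs n f = c :=
  ⟨ofCoeffs c, isHomogeneous_ofCoeffs c, funext fun u => coeff_ofCoeffs c u⟩

theorem map_vec (φ : S →+* T) (a b c : MvPolynomial (Fin 3) S) :
    (fun i => map φ (![a, b, c] i)) = ![map φ a, map φ b, map φ c] := by
  funext i
  fin_cases i <;> rfl

theorem isHomogeneous_vec {a b c : MvPolynomial (Fin 3) S} {l m n : ℕ} (ha : a.IsHomogeneous l)
    (hb : b.IsHomogeneous m) (hc : c.IsHomogeneous n) (i : Fin 3) :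
    (![a, b, c] i).IsHomogeneous (![l, m, n] i) := by
  fin_cases i
  exacts [ha, hb, hc]

theorem pos_vec {l m n : ℕ} (hl : 0 < l) (hm : 0 < m) (hn : 0 < n) (i : Fin 3) :
    0 < ![l, m, n] i := by
  fin_cases i
  exacts [hl, hm, hn]

/-- The resultant with two coordinate lines is the value at their intersection. -/
theorem res_X_X {S : Type} [CommRing S] {m : ℕ} (hm : 0 < m) {g : MvPolynomial (Fin 3) S}
    (hg : g.IsHomogeneous m) :
    res ![1, 1, m] ![X 0, X 1, g] = g.coeff (Finsupp.single 2 m) := by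
  have hd : ∀ i, 0 < ![1, 1, m] i := pos_vec one_pos one_pos hm
  have hspec : ∀ {S : Type} [CommRing S] {g : MvPolynomial (Fin 3) S}, g.IsHomogeneous m →
      subst (coeffs m g) (res ![1, 1, m] ![X 0, X 1, genericForm m]) =
        res ![1, 1, m] ![X 0, X 1, g] := fun hg => by
    rw [map_res, map_vec, map_X, map_X, map_genericForm hg]
  -- The two lines meet only in multiples of `(0, 0, 1)`, where `g` vanishes exactly if its
  -- coefficient of `x₂ ^ m` does. So the resultant is a constant times a power of this coefficient.
  obtain ⟨a, k, hk⟩ := exists_eq_C_mul_pow (P := res ![1, 1, m] ![X 0, X 1, genericForm m])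
    (X_prime (i := pureExponent 2 m)) fun c hc => by
      obtain ⟨g, hg, rfl⟩ := exists_coeffs_eq c
      have hh := isHomogeneous_vec (isHomogeneous_X ℂ 0) (isHomogeneous_X ℂ 1) hg
      rw [hspec hg, res_eq_zero_iff hd hh] at hc
      obtain ⟨z, hz, hzf⟩ := hc
      have h0 : z 0 = 0 := by simpa using hzf 0
      have h1 : z 1 = 0 := by simpa using hzf 1
      have h2 : eval z g = 0 := hzf 2
      have hz' : z = Pi.single 2 (z 2) := by
        funext i
        fin_cases i <;> simp [h0, h1]
      have hz2 : z 2 ≠ 0 := fun h2 => hz (by rw [hz', h2, Pi.single_zero])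
      rw [hz', eval_single_of_isHomogeneous hg] at h2
      rw [subst_X]
      exact (mul_eq_zero.mp h2).resolve_left (pow_ne_zero _ hz2)
  -- Evaluation at `g = t x₂ ^ m`, using that the resultant has degree 1 in `g`; then `t = 1` and `t
  -- = 2` determine `a` and `k`.
  have key : ∀ t : ℤ, a * t ^ k = t := fun t => by
    have hX : ∀ i, (![X 0, X 1, X 2 ^ m] i : MvPolynomial (Fin 3) ℤ).IsHomogeneous (![1, 1, m] i) :=
      isHomogeneous_vec (isHomogeneous_X ℤ 0) (isHomogeneous_X ℤ 1) (isHomogeneous_X_pow 2 m)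
    have h1 := hspec ((isHomogeneous_X_pow (R := ℤ) (2 : Fin 3) m).C_mul t)
    have h2 : (![X 0, X 1, C t * X 2 ^ m] : Fin 3 → MvPolynomial (Fin 3) ℤ) =
        scaleAt 2 t ![X 0, X 1, X 2 ^ m] := by
      funext i
      fin_cases i <;> simp [scaleAt]
    have h3 : (![X 0, X 1, X 2 ^ m] : Fin 3 → MvPolynomial (Fin 3) ℤ) =
        fun i => X i ^ ![1, 1, m] i := by
      funext i
      fin_cases i <;> simp
    have h4 : coeffs m (C t * X 2 ^ m) (pureExponent 2 m) = t := by
      rw [coeffs, coeff_C_mul, X_pow_eq_monomial]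
      simp [pureExponent]
    rw [h2, res_scaleAt hd 2 t hX, h3, res_X_pow hd, hk, map_mul, map_pow, subst_X,
      h4, subst, eval₂Hom_C] at h1
    simpa [blockDegree, Fin.prod_univ_three] using h1
  have ha : a = 1 := by simpa using key 1
  have hk1 : k = 1 := by
    have := key 2
    rw [ha, one_mul] at this
    exact Nat.pow_right_injective le_rfl (by simpa using (by exact_mod_cast this : 2 ^ k = 2))
  rw [← hspec hg, hk, ha, hk1, C_1, one_mul, pow_one, subst_X]
  rfl

/-! ### The resultant of the partial derivatives -/

/-- The resultant of the partial derivatives of a form of degree `n`. -/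
noncomputable def polarRes (n : ℕ) (f : MvPolynomial (Fin 3) S) : S :=
  res (fun _ => n - 1) fun i => pderiv i f

/-- The resultant of `x₀` and the partial derivatives in `x₁` and `x₂`. -/
noncomputable def lineRes (n : ℕ) (f : MvPolynomial (Fin 3) S) : S :=
  res ![1, n - 1, n - 1] ![X 0, pderiv 1 f, pderiv 2 f]

/-- The resultant of a form and its partial derivatives in `x₁` and `x₂`. -/
noncomputable def criticalRes (n : ℕ) (f : MvPolynomial (Fin 3) S) : S :=
  res ![n, n - 1, n - 1] ![f, pderiv 1 f, pderiv 2 f]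

/-- The resultant of `x₀`, a form and its partial derivative in `x₂`. -/
noncomputable def lineCriticalRes (n : ℕ) (f : MvPolynomial (Fin 3) S) : S :=
  res ![1, n, n - 1] ![X 0, f, pderiv 2 f]

theorem map_polarRes (φ : S →+* T) (n : ℕ) (f : MvPolynomial (Fin 3) S) :
    φ (polarRes n f) = polarRes n (map φ f) := by
  rw [polarRes, map_res]
  simp only [polarRes, pderiv_map]

theorem map_criticalRes (φ : S →+* T) (n : ℕ) (f : MvPolynomial (Fin 3) S) :
    φ (criticalRes n f) = criticalRes n (map φ f) := by
  rw [criticalRes, map_res, map_vec]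
  simp only [criticalRes, pderiv_map]

theorem map_lineCriticalRes (φ : S →+* T) (n : ℕ) (f : MvPolynomial (Fin 3) S) :
    φ (lineCriticalRes n f) = lineCriticalRes n (map φ f) := by
  rw [lineCriticalRes, map_res, map_vec]
  simp only [lineCriticalRes, pderiv_map, map_X]

theorem euler_identity {n : ℕ} {f : MvPolynomial (Fin 3) S} (hf : f.IsHomogeneous n) :
    X 0 * pderiv 0 f + X 1 * pderiv 1 f + X 2 * pderiv 2 f = C (n : S) * f := by
  have := hf.sum_X_mul_pderiv
  rwa [Fin.sum_univ_three, nsmul_eq_mul, ← map_natCast (C : S →+* MvPolynomial (Fin 3) S)] at this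

theorem isHomogeneous_X_mul_pderiv {n : ℕ} (hn : 0 < n) {f : MvPolynomial (Fin 3) S}
    (hf : f.IsHomogeneous n) (i : Fin 3) : (X i * pderiv i f).IsHomogeneous n := by
  have := (isHomogeneous_X S i).mul (hf.pderiv (i := i))
  rwa [Nat.add_sub_cancel' hn] at this

/-- Multiplicativity turns the left side into `Res(x₀ ∂₀f, ∂₁f, ∂₂f)`. By Euler `x₀ ∂₀f` is `n f`
modulo the other two forms, and the factor `n` comes out with exponent `(n-1)²`, the degree in the
first form. -/
theorem lineRes_mul_polarRes {S : Type} [CommRing S] [IsDomain S] {n : ℕ} (hn : 2 ≤ n)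
    {f : MvPolynomial (Fin 3) S} (hf : f.IsHomogeneous n) :
    lineRes n f * polarRes n f = n ^ (n - 1) ^ 2 * criticalRes n f := by
  have hm : 0 < n - 1 := by omega
  have hD : ∀ i, 0 < ![n, n - 1, n - 1] i := pos_vec (by omega) hm hm
  have hcrit : ∀ i, (![f, pderiv 1 f, pderiv 2 f] i).IsHomogeneous (![n, n - 1, n - 1] i) :=
    isHomogeneous_vec hf hf.pderiv hf.pderiv
  have hscale := isHomogeneous_scaleAt 0 (n : S) hcrit
  have h1 := res_update_mul (d := ![1, n - 1, n - 1]) (e := fun _ => n - 1)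
    (D := ![n, n - 1, n - 1]) (k := 0) (f := ![X 0, pderiv 1 f, pderiv 2 f]) (g := pderiv 0 f)
    (pos_vec one_pos hm hm) hm
    (fun i hi => by fin_cases i <;> simp_all) (fun i hi => by fin_cases i <;> simp_all)
    (by simp; omega) (isHomogeneous_vec (isHomogeneous_X S 0) hf.pderiv hf.pderiv) hf.pderiv
  have h2 := res_update_add hD hscale 0 (H := X 0 * pderiv 0 f - C (n : S) * f)
    ((isHomogeneous_X_mul_pderiv (by omega) hf 0).sub (hf.C_mul _))
    (fun i => -X i) (by
      rw [show (Finset.univ.erase 0 : Finset (Fin 3)) = {1, 2} by decide,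
        Finset.sum_pair (by decide)]
      simp only [scaleAt, ← euler_identity hf]
      simp
      ring)
  have e1 : Function.update (![X 0, pderiv 1 f, pderiv 2 f] : Fin 3 → MvPolynomial (Fin 3) S) 0
      (pderiv 0 f) = fun i => pderiv i f := by
    funext i
    fin_cases i <;> rfl
  have e2 : Function.update (scaleAt 0 (n : S) ![f, pderiv 1 f, pderiv 2 f]) 0
      (scaleAt 0 (n : S) ![f, pderiv 1 f, pderiv 2 f] 0 + (X 0 * pderiv 0 f - C (n : S) * f)) =
      Function.update ![X 0, pderiv 1 f, pderiv 2 f] 0 (X 0 * pderiv 0 f) := by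
    funext i
    fin_cases i <;> simp [scaleAt]
  rw [e2, res_scaleAt hD 0 _ hcrit] at h2
  rw [e1] at h1
  have h3 : blockDegree ![n, n - 1, n - 1] 0 = (n - 1) ^ 2 := by
    simp [blockDegree, Fin.prod_univ_three, sq]
  rw [lineRes, polarRes, ← h1, criticalRes, ← h3, ← h2]
  rfl

theorem coeff_single_pderiv {n : ℕ} (hn : 0 < n) (f : MvPolynomial (Fin 3) S) (i : Fin 3) :
    (pderiv i f).coeff (Finsupp.single i (n - 1)) = n * f.coeff (Finsupp.single i n) := by
  have hs : Finsupp.single i (n - 1) + Finsupp.single i 1 = Finsupp.single i n := by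
    rw [← Finsupp.single_add, Nat.sub_add_cancel hn]
  have hc : ((n - 1 : ℕ) : S) + 1 = n := by
    rw [← Nat.cast_add_one, Nat.sub_add_cancel hn]
  rw [coeff_pderiv, hs, Finsupp.single_eq_same, hc, mul_comm]

/-- The same argument applies to `x₁ ∂₁f`, which is `n f` modulo `x₀` and `∂₂f`. The factor `Res(x₀,
x₁, ∂₂f)` is the coefficient of `x₂ ^ (n-1)` in `∂₂f`. -/
theorem lineRes_mul_coeff {S : Type} [CommRing S] [IsDomain S] {n : ℕ} (hn : 2 ≤ n)
    {f : MvPolynomial (Fin 3) S} (hf : f.IsHomogeneous n) :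
    (n * f.coeff (Finsupp.single 2 n)) * lineRes n f = n ^ (n - 1) * lineCriticalRes n f := by
  have hm : 0 < n - 1 := by omega
  have hD : ∀ i, 0 < ![1, n, n - 1] i := pos_vec one_pos (by omega) hm
  have hcrit : ∀ i, (![X 0, f, pderiv 2 f] i).IsHomogeneous (![1, n, n - 1] i) :=
    isHomogeneous_vec (isHomogeneous_X S 0) hf hf.pderiv
  have hscale := isHomogeneous_scaleAt 1 (n : S) hcrit
  have h1 := res_update_mul (d := ![1, 1, n - 1]) (e := ![1, n - 1, n - 1])
    (D := ![1, n, n - 1]) (k := 1) (f := ![X 0, X 1, pderiv 2 f]) (g := pderiv 1 f)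
    (pos_vec one_pos one_pos hm) hm
    (fun i hi => by fin_cases i <;> simp_all) (fun i hi => by fin_cases i <;> simp_all)
    (by simp; omega) (isHomogeneous_vec (isHomogeneous_X S 0) (isHomogeneous_X S 1) hf.pderiv)
    hf.pderiv
  have h2 := res_update_add hD hscale 1 (H := X 1 * pderiv 1 f - C (n : S) * f)
    ((isHomogeneous_X_mul_pderiv (by omega) hf 1).sub (hf.C_mul _))
    ![-pderiv 0 f, 0, -X 2] (by
      rw [show (Finset.univ.erase 1 : Finset (Fin 3)) = {0, 2} by decide,
        Finset.sum_pair (by decide)]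
      simp only [scaleAt, ← euler_identity hf]
      simp
      ring)
  have e1 : Function.update (![X 0, X 1, pderiv 2 f] : Fin 3 → MvPolynomial (Fin 3) S) 1
      (pderiv 1 f) = ![X 0, pderiv 1 f, pderiv 2 f] := by
    funext i
    fin_cases i <;> rfl
  have e2 : Function.update (scaleAt 1 (n : S) ![X 0, f, pderiv 2 f]) 1
      (scaleAt 1 (n : S) ![X 0, f, pderiv 2 f] 1 + (X 1 * pderiv 1 f - C (n : S) * f)) =
      Function.update ![X 0, X 1, pderiv 2 f] 1 (X 1 * pderiv 1 f) := by
    funext i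
    fin_cases i <;> simp [scaleAt]
  rw [e2, res_scaleAt hD 1 _ hcrit] at h2
  rw [e1, res_X_X hm hf.pderiv, coeff_single_pderiv (by omega)] at h1
  have h3 : blockDegree ![1, n, n - 1] 1 = n - 1 := by
    simp [blockDegree, Fin.prod_univ_three]
  rw [h3] at h2
  rw [lineRes, ← h1, lineCriticalRes, ← h2]
  rfl

/-! ### The content of the resultant of the partial derivatives -/

theorem isHomogeneous_fermat (n : ℕ) :
    (X 0 ^ n + X 1 ^ n + X 2 ^ n : MvPolynomial (Fin 3) S).IsHomogeneous n :=
  ((isHomogeneous_X_pow _ _).add (isHomogeneous_X_pow _ _)).add (isHomogeneous_X_pow _ _)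

theorem pderiv_fermat (n : ℕ) (i : Fin 3) :
    pderiv i (X 0 ^ n + X 1 ^ n + X 2 ^ n : MvPolynomial (Fin 3) S) = C (n : S) * X i ^ (n - 1) := by
  rw [map_natCast]
  fin_cases i <;> simp [pderiv_X]

/-- A chain form without singularities in characteristics dividing its degree. -/
noncomputable def chainForm (n : ℕ) : MvPolynomial (Fin 3) S :=
  X 0 ^ (n - 1) * X 1 + X 1 ^ (n - 1) * X 2 + X 2 ^ n

theorem isHomogeneous_chainForm {n : ℕ} (hn : 0 < n) :
    (chainForm n : MvPolynomial (Fin 3) S).IsHomogeneous n := by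
  have h : ∀ i j : Fin 3, (X i ^ (n - 1) * X j : MvPolynomial (Fin 3) S).IsHomogeneous n :=
    fun i j => by
      have := (isHomogeneous_X_pow (R := S) i (n - 1)).mul (isHomogeneous_X S j)
      rwa [Nat.sub_add_cancel hn] at this
  exact ((h 0 1).add (h 1 2)).add (isHomogeneous_X_pow _ _)

theorem eval_chainForm (n : ℕ) (z : Fin 3 → S) :
    eval z (chainForm n) = z 0 ^ (n - 1) * z 1 + z 1 ^ (n - 1) * z 2 + z 2 ^ n := by
  simp [chainForm]

theorem eval_pderiv_one_chainForm (n : ℕ) (z : Fin 3 → S) :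
    eval z (pderiv 1 (chainForm n)) =
      z 0 ^ (n - 1) + (n - 1 : ℕ) * z 1 ^ (n - 1 - 1) * z 2 := by
  simp [chainForm, pderiv_X, mul_comm]

theorem eval_pderiv_two_chainForm (n : ℕ) (z : Fin 3 → S) :
    eval z (pderiv 2 (chainForm n)) = z 1 ^ (n - 1) + n * z 2 ^ (n - 1) := by
  simp [chainForm, pderiv_X]

/-- The Fermat form serves when `n` is invertible in `K`. When `n = 0` in `K` its derivatives vanish
identically, and the chain form is used: there `∂₂f`, `f` and then `∂₁f` (or `x₀`) force the
coordinates `z 1`, `z 2`, `z 0` to vanish in turn. -/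
theorem exists_criticalRes_ne_zero {K : Type*} [Field K] [IsAlgClosed K] {n : ℕ} (hn : 2 ≤ n) :
    ∃ f : MvPolynomial (Fin 3) K, f.IsHomogeneous n ∧ criticalRes n f ≠ 0 ∧
      lineCriticalRes n f ≠ 0 := by
  have hm : 0 < n - 1 := by omega
  have key : ∀ f : MvPolynomial (Fin 3) K, f.IsHomogeneous n →
      (∀ z, eval z f = 0 → eval z (pderiv 2 f) = 0 → z 0 = 0 ∨ eval z (pderiv 1 f) = 0 → z = 0) →
      criticalRes n f ≠ 0 ∧ lineCriticalRes n f ≠ 0 := by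
    intro f hf h
    constructor
    · rw [criticalRes, Ne, res_eq_zero_iff (pos_vec (by omega) hm hm)
        (isHomogeneous_vec hf hf.pderiv hf.pderiv)]
      rintro ⟨z, hz, hzf⟩
      exact hz (h z (hzf 0) (hzf 2) (.inr (hzf 1)))
    · rw [lineCriticalRes, Ne, res_eq_zero_iff (pos_vec one_pos (by omega) hm)
        (isHomogeneous_vec (isHomogeneous_X K 0) hf hf.pderiv)]
      rintro ⟨z, hz, hzf⟩
      exact hz (h z (hzf 1) (hzf 2) (.inl (by simpa using hzf 0)))
  by_cases hnK : (n : K) = 0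
  · refine ⟨chainForm n, isHomogeneous_chainForm (by omega),
      key _ (isHomogeneous_chainForm (by omega)) fun z hz hz2 hz1 => ?_⟩
    rw [eval_pderiv_two_chainForm, hnK, zero_mul, add_zero, pow_eq_zero_iff hm.ne'] at hz2
    rw [eval_chainForm, hz2, mul_zero, zero_pow hm.ne', zero_mul, zero_add, zero_add,
      pow_eq_zero_iff (by omega)] at hz
    have hz0 : z 0 = 0 := by
      rcases hz1 with h | h
      · exact h
      · rwa [eval_pderiv_one_chainForm, hz, mul_zero, add_zero, pow_eq_zero_iff hm.ne'] at h
    funext i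
    fin_cases i <;> assumption
  · refine ⟨_, isHomogeneous_fermat n, key _ (isHomogeneous_fermat n) fun z hz hz2 hz1 => ?_⟩
    have hd : ∀ i, eval z (pderiv i (X 0 ^ n + X 1 ^ n + X 2 ^ n)) = 0 → z i = 0 := fun i hi => by
      rw [pderiv_fermat, map_mul, eval_C, map_pow, eval_X] at hi
      exact (pow_eq_zero_iff hm.ne').mp ((mul_eq_zero.mp hi).resolve_left hnK)
    have h2 := hd 2 hz2
    have hn0 : n ≠ 0 := by omega
    simp only [map_add, map_pow, eval_X, h2, zero_pow hn0, add_zero] at hz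
    have h01 : z 0 = 0 ∧ z 1 = 0 := by
      rcases hz1 with h | h
      · rw [h, zero_pow hn0, zero_add, pow_eq_zero_iff hn0] at hz
        exact ⟨h, hz⟩
      · have h1 := hd 1 h
        rw [h1, zero_pow hn0, add_zero, pow_eq_zero_iff hn0] at hz
        exact ⟨hz, h1⟩
    funext i
    fin_cases i
    exacts [h01.1, h01.2, h2]

theorem isPrim_criticalRes {n : ℕ} (hn : 2 ≤ n) : IsPrim (criticalRes n (genericForm n)) := by
  refine isPrim_of_forall_exists fun p hp => ?_
  have := Fact.mk hp
  obtain ⟨f, hf, hne, -⟩ := exists_criticalRes_ne_zero (K := AlgebraicClosure (ZMod p)) hn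
  exact ⟨AlgebraicClosure (ZMod p), inferInstance,
    charP_of_injective_algebraMap (algebraMap (ZMod p) _).injective p, coeffs n f, by
      rwa [map_criticalRes, map_genericForm hf]⟩

theorem isPrim_lineCriticalRes {n : ℕ} (hn : 2 ≤ n) :
    IsPrim (lineCriticalRes n (genericForm n)) := by
  refine isPrim_of_forall_exists fun p hp => ?_
  have := Fact.mk hp
  obtain ⟨f, hf, -, hne⟩ := exists_criticalRes_ne_zero (K := AlgebraicClosure (ZMod p)) hn
  exact ⟨AlgebraicClosure (ZMod p), inferInstance,
    charP_of_injective_algebraMap (algebraMap (ZMod p) _).injective p, coeffs n f, by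
      rwa [map_lineCriticalRes, map_genericForm hf]⟩

/-- The content of the resultant of the partial derivatives of the generic form. -/
theorem exists_isPrim_polarRes {n : ℕ} (hn : 2 ≤ n) : ∃ P, IsPrim P ∧
    polarRes n (genericForm n) = (n : MvPolynomial (Exponents n) ℤ) ^ ((n - 1) ^ 2 - (n - 2)) * P := by
  have hn0 : (n : MvPolynomial (Exponents n) ℤ) ≠ 0 := Nat.cast_ne_zero.mpr (by omega)
  have hN : ∀ k, n ^ k ≠ 0 := fun k => pow_ne_zero _ (by omega)
  have hle : n - 2 ≤ (n - 1) ^ 2 :=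
    (Nat.sub_le_sub_left one_le_two n).trans (Nat.le_self_pow two_ne_zero _)
  have h1 := lineRes_mul_polarRes hn (isHomogeneous_genericForm n)
  have h2 := lineRes_mul_coeff hn (isHomogeneous_genericForm n)
  -- The coefficient is a variable, hence primitive, and one factor `n` cancels. Therefore exactly
  -- `n ^ (n - 2)` splits off from `lineRes`, leaving a primitive cofactor `L`.
  rw [show (genericForm n).coeff (Finsupp.single 2 n) = X (pureExponent 2 n) from
    coeff_ofCoeffs X (pureExponent 2 n), show n - 1 = (n - 2) + 1 by omega, pow_succ',
    mul_assoc, mul_assoc] at h2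
  replace h2 := mul_left_cancel₀ hn0 h2
  obtain ⟨L, hL⟩ : ((n ^ (n - 2) : ℕ) : MvPolynomial (Exponents n) ℤ) ∣ lineRes n (genericForm n) :=
    (isPrim_X (pureExponent 2 n)).dvd_of_dvd_mul (hN _) (by
      rw [mul_comm, h2, Nat.cast_pow]
      exact dvd_mul_right _ _)
  rw [Nat.cast_pow] at hL
  rw [hL, mul_left_comm] at h2
  replace h2 := mul_left_cancel₀ (pow_ne_zero _ hn0) h2
  have hLp : IsPrim L := (isPrim_lineCriticalRes hn).of_dvd (h2 ▸ dvd_mul_left _ _)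
  rw [hL, mul_assoc, ← Nat.add_sub_cancel' hle, pow_add, mul_assoc, mul_comm L] at h1
  replace h1 := mul_left_cancel₀ (pow_ne_zero _ hn0) h1
  obtain ⟨P, hP⟩ : ((n ^ ((n - 1) ^ 2 - (n - 2)) : ℕ) : MvPolynomial (Exponents n) ℤ) ∣
      polarRes n (genericForm n) := hLp.dvd_of_dvd_mul (hN _) (by
    rw [h1, Nat.cast_pow]
    exact dvd_mul_right _ _)
  rw [Nat.cast_pow] at hP
  rw [hP, mul_assoc] at h1
  replace h1 := mul_left_cancel₀ (pow_ne_zero _ hn0) h1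
  exact ⟨P, (isPrim_criticalRes hn).of_dvd (h1 ▸ dvd_mul_right _ _), hP⟩

/-! ### Irreducibility of the discriminant -/

/-- A form of degree `n` singular at `z`, equal to `f` if `f` is singular at `z` and
`ℓ(z) = ∑ i, l i * z i` is `1`. -/
noncomputable def forceSingular (n : ℕ) (f : MvPolynomial (Fin 3) S) (z l : Fin 3 → S) :
    MvPolynomial (Fin 3) S :=
  C ((∑ i, l i * z i) ^ n) * f -
    C (∑ i, l i * z i) * ((∑ i, C (l i) * X i) ^ (n - 1) * ∑ i, C (eval z (pderiv i f)) * X i) +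
    C ((n - 1 : ℕ) * eval z f) * (∑ i, C (l i) * X i) ^ n

theorem isHomogeneous_forceSingular {n : ℕ} (hn : 0 < n) {f : MvPolynomial (Fin 3) S}
    (hf : f.IsHomogeneous n) (z l : Fin 3 → S) : (forceSingular n f z l).IsHomogeneous n := by
  have hl := isHomogeneous_linearForm l
  have h1 := (hl.pow (n - 1)).mul (isHomogeneous_linearForm fun i => eval z (pderiv i f))
  have h2 := hl.pow n
  rw [one_mul, Nat.sub_add_cancel hn] at h1
  rw [one_mul] at h2
  exact ((hf.C_mul _).sub (h1.C_mul _)).add (h2.C_mul _)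

theorem pderiv_linearForm (l : Fin 3 → S) (j : Fin 3) :
    pderiv j (∑ i, C (l i) * X i : MvPolynomial (Fin 3) S) = C (l j) := by
  simp [pderiv_X, Pi.single_apply]

/-- The second term of `forceSingular` cancels the derivative of the first but, by Euler's identity,
leaves a multiple of `n (n - 1) f(z) ℓ(z) ^ (n-1)`, which the third term removes. No division by `n`
is needed. -/
theorem eval_pderiv_forceSingular {n : ℕ} (hn : 0 < n) {f : MvPolynomial (Fin 3) S}
    (hf : f.IsHomogeneous n) (z l : Fin 3 → S) (j : Fin 3) :
    eval z (pderiv j (forceSingular n f z l)) = 0 := by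
  obtain ⟨m, rfl⟩ : ∃ m, n = m + 1 := ⟨n - 1, by omega⟩
  have he : ∑ i, eval z (pderiv i f) * z i = (m + 1 : ℕ) * eval z f := by
    have := congrArg (eval z) hf.sum_X_mul_pderiv
    simpa [mul_comm] using this
  have hlin : ∀ l : Fin 3 → S, eval z (∑ i, C (l i) * X i) = ∑ i, l i * z i := fun l => by simp
  rw [forceSingular, map_add, map_sub, pderiv_C_mul, pderiv_C_mul, pderiv_C_mul, pderiv_mul,
    pderiv_pow, pderiv_pow, pderiv_linearForm, pderiv_linearForm]
  simp only [map_add, map_sub, map_mul, map_pow, eval_C, hlin, he, map_natCast,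
    Nat.add_sub_cancel]
  rcases m with _ | m
  · simp
  · simp only [Nat.add_sub_cancel]
    push_cast
    ring

theorem map_forceSingular (φ : S →+* T) (n : ℕ) (f : MvPolynomial (Fin 3) S) (z l : Fin 3 → S) :
    map φ (forceSingular n f z l) =
      forceSingular n (map φ f) (fun i => φ (z i)) fun i => φ (l i) := by
  simp only [forceSingular, map_add, map_sub, map_mul, map_pow, map_C, map_sum, map_X,
    map_eval_point φ, map_natCast, pderiv_map]

/-- Substitution of the generic singular form. -/
noncomputable def singularHom (n : ℕ) :
    MvPolynomial (Exponents n) ℤ →+* MvPolynomial (Exponents n ⊕ (Fin 3 ⊕ Fin 3)) ℤ :=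
  subst (coeffs n (forceSingular n (ofCoeffs fun u : Exponents n => X (.inl u))
    (fun i => X (.inr (.inl i))) fun i => X (.inr (.inr i))))

theorem singularHom_polarRes {n : ℕ} (hn : 2 ≤ n) :
    singularHom n (polarRes n (genericForm n)) = 0 := by
  have hh := isHomogeneous_forceSingular (by omega : 0 < n)
    (isHomogeneous_ofCoeffs fun u : Exponents n =>
      (X (.inl u) : MvPolynomial (Exponents n ⊕ (Fin 3 ⊕ Fin 3)) ℤ))
    (fun i => X (.inr (.inl i))) fun i => X (.inr (.inr i))
  rw [singularHom, map_polarRes, map_genericForm hh]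
  refine res_eq_zero_of_hasCommonZero (fun _ => by omega) (fun i => hh.pderiv)
    ⟨fun i => X (.inr (.inl i)), Function.ne_iff.mpr ⟨0, X_ne_zero _⟩, fun i => ?_⟩
  exact eval_pderiv_forceSingular (by omega) (isHomogeneous_ofCoeffs _) _ _ i

theorem subst_eq_zero_of_isSingular {n : ℕ} {P : MvPolynomial (Exponents n) ℤ}
    (hP : singularHom n P = 0) {f : MvPolynomial (Fin 3) ℂ} (hf : f.IsHomogeneous n)
    (h : IsSingular f) : subst (coeffs n f) P = 0 := by
  obtain ⟨z, hz, hzf, hzd⟩ := h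
  obtain ⟨j, hj⟩ := Function.ne_iff.mp hz
  have hfs : forceSingular n f z (Pi.single j (z j)⁻¹) = f := by
    have : ∑ i, (Pi.single j (z j)⁻¹ : Fin 3 → ℂ) i * z i = 1 := by
      simpa [Pi.single_apply] using inv_mul_cancel₀ hj
    simp [forceSingular, this, hzf, hzd]
  let φ : MvPolynomial (Exponents n ⊕ (Fin 3 ⊕ Fin 3)) ℤ →+* ℂ :=
    subst (Sum.elim (coeffs n f) (Sum.elim z (Pi.single j (z j)⁻¹)))
  have h := congrArg φ hP
  rw [singularHom, map_subst, map_zero] at h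
  rw [← h]
  congr 2
  funext u
  simp only [coeffs]
  rw [← coeff_map, map_forceSingular, map_ofCoeffs]
  simp only [φ, subst_X, Sum.elim_inl, Sum.elim_inr]
  rw [show ofCoeffs (coeffs n f) = f from ofCoeffs_coeff hf, hfs]

theorem polarRes_eq_zero_iff {n : ℕ} (hn : 2 ≤ n) {f : MvPolynomial (Fin 3) ℂ}
    (hf : f.IsHomogeneous n) : polarRes n f = 0 ↔ IsSingular f := by
  rw [polarRes, res_eq_zero_iff (fun _ => by omega) fun i => hf.pderiv]
  refine exists_congr fun z => and_congr_right fun _ =>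
    ⟨fun h => ⟨?_, h⟩, fun h => h.2⟩
  have := congrArg (eval z) (euler_identity hf)
  simp only [map_add, map_mul, h, mul_zero, add_zero, eval_C] at this
  exact (mul_eq_zero.mp this.symm).resolve_left (by exact_mod_cast (by omega : n ≠ 0))

/-! #### A pencil with simple singular members -/

/-- The form `s₁ (x₁ ^ n - n x₁ x₀ ^ (n - 1)) + s₂ (x₂ ^ n - n x₂ x₀ ^ (n - 1))`. -/
noncomputable def pencilForm (n : ℕ) (s : Fin 3 → ℂ) : MvPolynomial (Fin 3) ℂ :=
  C (s 1) * (X 1 ^ n - C (n : ℂ) * (X 0 ^ (n - 1) * X 1)) +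
    C (s 2) * (X 2 ^ n - C (n : ℂ) * (X 0 ^ (n - 1) * X 2))

theorem isHomogeneous_pencilForm {n : ℕ} (hn : 0 < n) (s : Fin 3 → ℂ) :
    (pencilForm n s).IsHomogeneous n := by
  have h : ∀ i j : Fin 3, (X i ^ (n - 1) * X j : MvPolynomial (Fin 3) ℂ).IsHomogeneous n :=
    fun i j => by
      have := (isHomogeneous_X_pow (R := ℂ) i (n - 1)).mul (isHomogeneous_X ℂ j)
      rwa [Nat.sub_add_cancel hn] at this
  exact (((isHomogeneous_X_pow _ _).sub ((h 0 1).C_mul _)).C_mul _).add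
    (((isHomogeneous_X_pow _ _).sub ((h 0 2).C_mul _)).C_mul _)

theorem pderiv_one_pencilForm (n : ℕ) (s : Fin 3 → ℂ) (t : ℂ) :
    pderiv 1 (pencilForm n s + C t * X 0 ^ n) =
      C (s 1 * n) * (X 1 ^ (n - 1) - X 0 ^ (n - 1)) := by
  simp [pencilForm, pderiv_X]
  ring

theorem pderiv_two_pencilForm (n : ℕ) (s : Fin 3 → ℂ) (t : ℂ) :
    pderiv 2 (pencilForm n s + C t * X 0 ^ n) =
      C (s 2 * n) * (X 2 ^ (n - 1) - X 0 ^ (n - 1)) := by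
  simp [pencilForm, pderiv_X]
  ring

theorem eval_pencilForm {n : ℕ} (hn : 0 < n) (s : Fin 3 → ℂ) {w : Fin 3 → ℂ} (h0 : w 0 = 1)
    (h1 : w 1 ^ (n - 1) = 1) (h2 : w 2 ^ (n - 1) = 1) :
    eval w (pencilForm n s) = (1 - n) * (s 1 * w 1 + s 2 * w 2) := by
  obtain ⟨m, rfl⟩ : ∃ m, n = m + 1 := ⟨n - 1, by omega⟩
  simp only [Nat.add_sub_cancel] at h1 h2
  simp only [pencilForm, Nat.add_sub_cancel, map_add, map_sub, map_mul, map_pow, eval_C, eval_X, h0,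
    one_pow, one_mul, pow_succ, h1, h2]
  ring

/-- There is a pencil of forms on which the resultant of a member and two of its derivatives has
simple roots only. -/
theorem exists_pencil {n : ℕ} (hn : 2 ≤ n) : ∃ (s : Fin 3 → ℂ) (q : Polynomial ℂ),
    q.roots.Nodup ∧ q ≠ 0 ∧ (∃ t, q.eval t = 0) ∧
    ∀ t, criticalRes n (pencilForm n s + C t * X 0 ^ n) = q.eval t := by
  have hm : 0 < n - 1 := by omega
  have hd : ∀ i, 0 < ![n, n - 1, n - 1] i := pos_vec (by omega) hm hm
  obtain ⟨s, hs0, hs⟩ := exists_injOn_linear (unityPoints ![n, n - 1, n - 1] 0)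
  have hh : (pencilForm n s).IsHomogeneous n := isHomogeneous_pencilForm (by omega) s
  have hn0 : (n : ℂ) ≠ 0 := by exact_mod_cast (by omega : n ≠ 0)
  have hn1 : (1 - n : ℂ) ≠ 0 := sub_ne_zero.mpr (by exact_mod_cast (by omega : 1 ≠ n))
  have hev : ∀ w ∈ unityPoints ![n, n - 1, n - 1] 0, w 0 = 1 ∧
      eval w (pencilForm n s) = (1 - n) * (s 1 * w 1 + s 2 * w 2) := fun w hw => by
    obtain ⟨h0, h⟩ := (mem_unityPoints hd).mp hw
    exact ⟨h0, eval_pencilForm (by omega) s h0 (h 1 (by decide)) (h 2 (by decide))⟩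
  have hinj : Set.InjOn (fun w => eval w (pencilForm n s)) (unityPoints ![n, n - 1, n - 1] 0) := by
    intro w hw w' hw' he
    refine hs hw hw' ?_
    obtain ⟨h0, h1⟩ := hev w hw
    obtain ⟨h0', h1'⟩ := hev w' hw'
    simp only [h1, h1'] at he
    simp only [Fin.sum_univ_three, h0, h0']
    linear_combination mul_left_cancel₀ hn1 he
  let q₀ := resLine ![n, n - 1, n - 1]
    (Function.update (unityForms ![n, n - 1, n - 1] 0) 0 (pencilForm n s)) 0 (X 0 ^ n)
  -- The derivatives in `x₁` and `x₂` along the pencil are these multiples of `xᵢ ^ (n-1) - x₀ ^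
  -- (n-1)`, so the model system with simple roots applies up to the factor `κ`.
  let c : Fin 3 → ℂ := ![1, s 1 * n, s 2 * n]
  let κ : ℂ := ∏ i, c i ^ blockDegree ![n, n - 1, n - 1] i
  have hκ : κ ≠ 0 := Finset.prod_ne_zero_iff.mpr fun i _ => pow_ne_zero _ (by
    fin_cases i
    · exact one_ne_zero
    · exact mul_ne_zero (hs0 1) hn0
    · exact mul_ne_zero (hs0 2) hn0)
  have hq₀ : q₀ ≠ 0 := resLine_unityForms_ne_zero hd 0 hh
  refine ⟨s, Polynomial.C κ * q₀, ?_, mul_ne_zero (by simpa using hκ) hq₀, ?_, fun t => ?_⟩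
  · rw [Polynomial.roots_C_mul _ hκ]
    exact nodup_roots_resLine_unityForms hd 0 hh hinj
  · refine ⟨-eval 1 (pencilForm n s), ?_⟩
    have hroot : q₀.eval (-eval 1 (pencilForm n s)) = 0 :=
      (eval_resLine_unityForms_eq_zero_iff hd 0 hh _).mpr
        ⟨1, (mem_unityPoints hd).mpr ⟨rfl, fun i _ => one_pow _⟩, rfl⟩
    rw [Polynomial.eval_mul, hroot, mul_zero]
  · have hhom := isHomogeneous_update (isHomogeneous_update (isHomogeneous_unityForms
      ![n, n - 1, n - 1] 0) (k := 0) hh) (k := 0) (h := pencilForm n s + C t * X 0 ^ n)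
      (hh.add ((isHomogeneous_X_pow _ _).C_mul _))
    rw [Polynomial.eval_mul, Polynomial.eval_C, eval_resLine, Function.update_self, criticalRes,
      pderiv_one_pencilForm, pderiv_two_pencilForm, ← res_C_mul hd c hhom]
    congr 1
    funext i
    fin_cases i <;> simp [c, unityForms]

theorem isUnit_of_isPrim_C_mul {σ : Type*} {a : ℤ} {P : MvPolynomial σ ℤ} (h : IsPrim (C a * P)) :
    IsUnit a := by
  rw [Int.isUnit_iff_natAbs_eq]
  by_contra hne
  obtain ⟨p, hp, hdvd⟩ := Nat.exists_prime_and_dvd hne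
  refine h p hp (Dvd.dvd.mul_right ?_ _)
  rw [← map_natCast (C : ℤ →+* MvPolynomial σ ℤ)]
  exact map_dvd C (Int.natCast_dvd.mpr hdvd)

/-- The primitive part of the resultant of the partial derivatives is prime. -/
theorem prime_of_polarRes_eq {n : ℕ} (hn : 2 ≤ n) {P : MvPolynomial (Exponents n) ℤ}
    (hP : IsPrim P) {N : ℕ} (hN : polarRes n (genericForm n) =
      (n : MvPolynomial (Exponents n) ℤ) ^ N * P) : Prime P := by
  have hn0 : n ≠ 0 := by omega
  have hP0 : P ≠ 0 := fun h => hP 2 Nat.prime_two (h ▸ dvd_zero _)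
  have hval : ∀ {f : MvPolynomial (Fin 3) ℂ}, f.IsHomogeneous n →
      polarRes n f = n ^ N * subst (coeffs n f) P := fun {f} hf => by
    have := congrArg (subst (coeffs n f)) hN
    rwa [map_polarRes, map_genericForm hf, map_mul, map_pow, map_natCast] at this
  have hker : P ∈ RingHom.ker (singularHom n) := by
    have := singularHom_polarRes hn
    rw [hN, map_mul, map_pow, map_natCast] at this
    exact (mul_eq_zero.mp this).resolve_left (pow_ne_zero _ (Nat.cast_ne_zero.mpr hn0))
  -- This prime factor vanishes at every singular form, hence at every complex zero of `P`; so `P`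
  -- is a constant times a power of it.
  obtain ⟨Q, hQ, hQp, hQP⟩ := exists_prime_dvd_mem (RingHom.ker_isPrime _) hker hP0
  obtain ⟨a, k, hk⟩ := exists_eq_C_mul_pow (P := P) hQp fun c hc => by
    obtain ⟨f, hf, rfl⟩ := exists_coeffs_eq c
    refine subst_eq_zero_of_isSingular hQ hf ((polarRes_eq_zero_iff hn hf).mp ?_)
    rw [hval hf, hc, mul_zero]
  have ha : IsUnit a := isUnit_of_isPrim_C_mul (hk ▸ hP)
  suffices hk1 : k = 1 by
    rw [hk, hk1, pow_one]
    exact (associated_unit_mul_left Q _ (ha.map C)).symm.prime hQp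
  obtain ⟨s, q, hnodup, hq0, ⟨t₀, ht₀⟩, hq⟩ := exists_pencil hn
  have hhom : ∀ t : ℂ, (pencilForm n s + C t * X 0 ^ n).IsHomogeneous n := fun t =>
    (isHomogeneous_pencilForm (by omega) s).add ((isHomogeneous_X_pow _ _).C_mul t)
  let δ : Polynomial ℂ := subst (coeffs n (map Polynomial.C (pencilForm n s) +
    C Polynomial.X * X 0 ^ n)) Q
  have hδ : ∀ t, δ.eval t = subst (coeffs n (pencilForm n s + C t * X 0 ^ n)) Q := fun t => by
    rw [← Polynomial.coe_evalRingHom, map_subst]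
    congr 2
    funext u
    rw [coeffs, ← coeff_map]
    simp [map_map, evalRingHom_comp_C, MvPolynomial.map_id, coeffs]
  -- The derivatives in `x₁` and `x₂` do not see the term `t x₀ ^ n`. So on the pencil the critical
  -- resultant is a constant times a `k`-th power, and a simple root of it gives `k = 1`.
  have hline : ∀ t, lineRes n (pencilForm n s + C t * X 0 ^ n) = lineRes n (pencilForm n s) :=
    fun t => by
      have h0 := pderiv_one_pencilForm n s 0
      have h0' := pderiv_two_pencilForm n s 0
      rw [C_0, zero_mul, add_zero] at h0 h0'
      rw [lineRes, lineRes, pderiv_one_pencilForm, pderiv_two_pencilForm, h0, h0']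
  have hn0' : (n : ℂ) ≠ 0 := Nat.cast_ne_zero.mpr hn0
  obtain ⟨κ, hκ⟩ : ∃ κ : ℂ, Polynomial.C κ * δ ^ k = q := by
    refine ⟨lineRes n (pencilForm n s) * n ^ N * a / n ^ (n - 1) ^ 2, Polynomial.funext fun t => ?_⟩
    have h1 := lineRes_mul_polarRes hn (hhom t)
    rw [hline, hval (hhom t), hq, hk, map_mul, map_pow, ← hδ, subst, eval₂Hom_C,
      Int.coe_castRingHom] at h1
    rw [Polynomial.eval_mul, Polynomial.eval_C, Polynomial.eval_pow, div_mul_eq_mul_div,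
      div_eq_iff (pow_ne_zero _ hn0')]
    linear_combination h1
  have hκ0 : κ ≠ 0 := fun h => hq0 (by rw [← hκ, h, Polynomial.C_0, zero_mul])
  rw [← hκ, Polynomial.eval_mul, Polynomial.eval_C, Polynomial.eval_pow, mul_eq_zero] at ht₀
  have ht₁ := ht₀.resolve_left hκ0
  have hk0 : k ≠ 0 := fun h => by
    rw [h, pow_zero] at ht₁
    exact one_ne_zero ht₁
  have hdvd : (Polynomial.X - Polynomial.C t₀) ^ k ∣ q := by
    rw [← hκ]
    exact (pow_dvd_pow_of_dvd (Polynomial.dvd_iff_isRoot.mpr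
      ((pow_eq_zero_iff hk0).mp ht₁)) k).mul_left _
  have h1 := (Polynomial.le_rootMultiplicity_iff hq0).mpr hdvd
  have h2 := Multiset.nodup_iff_count_le_one.mp hnodup t₀
  rw [Polynomial.count_roots] at h2
  omega

/-! ### Existence and uniqueness of the resultant and of the discriminant -/

/-- Irreducible integer polynomials with the same nonempty set of complex zeros agree up to
sign. -/
theorem eq_or_eq_neg_of_zeros {σ : Type*} [Finite σ] {P Q : MvPolynomial σ ℤ} (hP : Irreducible P)
    (hQ : Irreducible Q) (h : ∀ c : σ → ℂ, subst c P = 0 ↔ subst c Q = 0) {c : σ → ℂ}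
    (hc : subst c P = 0) : Q = P ∨ Q = -P := by
  obtain ⟨u, rfl⟩ := associated_of_dvd_dvd
    (dvd_of_forall_subst_eq_zero hP.prime hc fun c => (h c).mp)
    (dvd_of_forall_subst_eq_zero hQ.prime ((h c).mp hc) fun c => (h c).mpr)
  obtain ⟨b, hb, hu⟩ := (dvd_C_iff_exists (f := (u : MvPolynomial σ ℤ)) (one_ne_zero (α := ℤ))).mp
    u.isUnit.dvd
  rw [hu]
  rcases Int.isUnit_iff.mp (isUnit_of_dvd_one hb) with rfl | rfl
  · left
    rw [C_1, mul_one]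
  · right
    rw [C_neg, C_1, mul_neg, mul_one]

theorem isPrim_of_subst_eq_one {σ : Type*} {P : MvPolynomial σ ℤ} {c : σ → ℤ}
    (h : subst c P = 1) : IsPrim P := by
  rintro p hp ⟨Q, rfl⟩
  rw [map_mul, map_natCast] at h
  exact (Nat.prime_iff_prime_int.mp hp).not_isUnit (.of_mul_eq_one _ h)

theorem evalAtTriple_rename {n : ℕ} (P : MvPolynomial (CoeffIndex fun _ => n) ℤ)
    (f : Fin 3 → MvPolynomial (Fin 3) S) :
    evalAtTriple (rename (Equiv.sigmaEquivProd (Fin 3) (Exponents n)) P) f = evalForms P f := by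
  rw [evalAtTriple, aeval_eq_subst, subst_rename]
  rfl

theorem isResultant_resultant {n : ℕ} (hn : 0 < n) : IsResultant n
    (rename (Equiv.sigmaEquivProd (Fin 3) (Exponents n)) (resultant fun _ => n)) where
  eval_eq_zero_iff f hf := by
    rw [evalAtTriple_rename]
    exact res_eq_zero_iff (fun _ => hn) hf
  irreducible := (prime_rename_of_injective (Equiv.injective _)
    (resultant_spec fun _ => hn).1).irreducible
  content := by
    refine (isPrim_of_subst_eq_one (c := fun p => coeffs n (X p.1 ^ n) p.2) ?_).hasContentOne
    rw [subst_rename]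
    exact res_X_pow (d := fun _ => n) fun _ => hn
  normalized := by
    rw [evalAtTriple_rename]
    exact res_X_pow (d := fun _ => n) fun _ => hn

theorem IsResultant.unique {n : ℕ} {R R' : MvPolynomial (Fin 3 × Exponents n) ℤ}
    (h : IsResultant n R) (h' : IsResultant n R') : R' = R := by
  have hform : ∀ c : Fin 3 × Exponents n → ℂ, ∃ f : Fin 3 → MvPolynomial (Fin 3) ℂ,
      (∀ i, (f i).IsHomogeneous n) ∧ ∀ P : MvPolynomial (Fin 3 × Exponents n) ℤ,
        subst c P = evalAtTriple P f := fun c =>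
    ⟨fun i => ofCoeffs fun u => c (i, u), fun i => isHomogeneous_ofCoeffs _, fun P =>
      congrArg (fun c => subst c P) (funext fun p => (coeff_ofCoeffs (fun u => c (p.1, u)) p.2).symm)⟩
  have hzero : subst (fun _ => (0 : ℂ)) R = 0 :=
    (h.eval_eq_zero_iff (fun _ => 0) fun i => isHomogeneous_zero _ _ _).mpr
      ⟨1, one_ne_zero, fun _ => map_zero _⟩
  rcases eq_or_eq_neg_of_zeros h.irreducible h'.irreducible (fun c => by
    obtain ⟨f, hf, hev⟩ := hform c
    rw [hev, hev, h.eval_eq_zero_iff f hf, h'.eval_eq_zero_iff f hf]) hzero with he | he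
  · exact he
  · have h1 := h'.normalized
    have h2 := h.normalized
    rw [evalAtTriple] at h1 h2
    rw [he, map_neg, h2] at h1
    norm_num at h1

theorem IsDiscriminant.unique {n : ℕ} {Δ Δ' : MvPolynomial (Exponents n) ℤ}
    (h : IsDiscriminant n Δ) (h' : IsDiscriminant n Δ') : Δ' = Δ := by
  have hzero : subst (coeffs n (0 : MvPolynomial (Fin 3) ℂ)) Δ = 0 :=
    (h.eval_eq_zero_iff 0 (isHomogeneous_zero _ _ _)).mpr
      ⟨1, one_ne_zero, map_zero _, fun i => by rw [map_zero, map_zero]⟩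
  rcases eq_or_eq_neg_of_zeros h.irreducible h'.irreducible (fun c => by
    obtain ⟨f, hf, rfl⟩ := exists_coeffs_eq c
    exact (h.eval_eq_zero_iff f hf).trans (h'.eval_eq_zero_iff f hf).symm) hzero with he | he
  · exact he
  · have h1 := h'.neg
    have h2 := h.neg
    rw [evalAt] at h1 h2
    rw [he, map_neg] at h1
    omega

/-- The derivatives are `n xᵢ ^ (n-1)`, so the value is a product of powers of `n`. This decides the
sign in the definition of the discriminant. -/
theorem polarRes_fermat_pos {n : ℕ} (hn : 2 ≤ n) :
    0 < polarRes n (X 0 ^ n + X 1 ^ n + X 2 ^ n : MvPolynomial (Fin 3) ℤ) := by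
  have hd : ∀ _ : Fin 3, 0 < n - 1 := fun _ => by omega
  simp only [polarRes, pderiv_fermat]
  rw [res_C_mul hd _ fun i => isHomogeneous_X_pow _ _, res_X_pow (d := fun _ => n - 1) hd, mul_one]
  exact Finset.prod_pos fun i _ => pow_pos (by exact_mod_cast (by omega : 0 < n)) _

/-- The discriminant exists and is the resultant of the partial derivatives up to a constant. -/
theorem exists_isDiscriminant {n : ℕ} (hn : 2 ≤ n) : ∃ Δ, IsDiscriminant n Δ ∧
    ∀ f : MvPolynomial (Fin 3) ℂ, f.IsHomogeneous n →
      polarRes n f = -(n : ℂ) ^ ((n - 1) ^ 2 - (n - 2)) * evalAt Δ f := by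
  obtain ⟨P, hP, hPn⟩ := exists_isPrim_polarRes hn
  have hprime := prime_of_polarRes_eq hn hP hPn
  have hval : ∀ {A : Type} [CommRing A] {f : MvPolynomial (Fin 3) A}, f.IsHomogeneous n →
      polarRes n f = (n : A) ^ ((n - 1) ^ 2 - (n - 2)) * subst (coeffs n f) P := by
    intro A _ f hf
    have := congrArg (subst (coeffs n f)) hPn
    rwa [map_polarRes, map_genericForm hf, map_mul, map_pow, map_natCast] at this
  have hneg : ∀ {A : Type} [CommRing A] (f : MvPolynomial (Fin 3) A),
      evalAt (-P) f = -subst (coeffs n f) P := fun f => map_neg (subst (coeffs n f)) P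
  refine ⟨-P, ⟨fun f hf => ?_, hprime.neg.irreducible, IsPrim.hasContentOne ?_, ?_⟩, fun f hf => ?_⟩
  · rw [← polarRes_eq_zero_iff hn hf, hval hf, hneg, neg_eq_zero, mul_eq_zero, or_iff_right]
    exact pow_ne_zero _ (by exact_mod_cast (by omega : n ≠ 0))
  · exact hP.of_dvd (neg_dvd.mpr dvd_rfl)
  · have h := polarRes_fermat_pos hn
    rw [hval (isHomogeneous_fermat n)] at h
    rw [hneg]
    exact neg_neg_of_pos (pos_of_mul_pos_right h (by positivity))
  · rw [hval hf, hneg, neg_mul_neg]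

end TernaryForm

/-! ### The proposition. -/

theorem mainTheorem1 (d : ℕ) (hd : 2 ≤ d) :
    (∃! Δ : MvPolynomial (TernaryForm.Exponents d) ℤ, TernaryForm.IsDiscriminant d Δ) ∧
    (∃! R : MvPolynomial (Fin 3 × TernaryForm.Exponents (d - 1)) ℤ,
      TernaryForm.IsResultant (d - 1) R) ∧
    ∀ (Δ : MvPolynomial (TernaryForm.Exponents d) ℤ)
      (R : MvPolynomial (Fin 3 × TernaryForm.Exponents (d - 1)) ℤ),
      TernaryForm.IsDiscriminant d Δ → TernaryForm.IsResultant (d - 1) R →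
      ∀ f : MvPolynomial (Fin 3) ℂ, f.IsHomogeneous d →
        TernaryForm.evalAt Δ f =
          -(d : ℂ) ^ (-(d : ℤ) ^ 2 + 3 * (d : ℤ) - 3) *
            TernaryForm.evalAtTriple R (fun i => MvPolynomial.pderiv i f) := by
  obtain ⟨Δ₀, hΔ₀, hformula⟩ := TernaryForm.exists_isDiscriminant hd
  have hR₀ := TernaryForm.isResultant_resultant (n := d - 1) (by omega)
  refine ⟨⟨Δ₀, hΔ₀, fun Δ hΔ => hΔ₀.unique hΔ⟩, ⟨_, hR₀, fun R hR => hR₀.unique hR⟩,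
    fun Δ R hΔ hR f hf => ?_⟩
  obtain rfl := hΔ₀.unique hΔ
  have hpolar : TernaryForm.evalAtTriple R (fun i => MvPolynomial.pderiv i f) =
      TernaryForm.polarRes d f := by
    rw [hR₀.unique hR, TernaryForm.evalAtTriple_rename]
    rfl
  have hd0 : (d : ℂ) ≠ 0 := Nat.cast_ne_zero.mpr (by omega)
  -- With `d = m + 2` the truncated subtractions are exact, since `m ≤ (m + 1) ^ 2`.
  have hexp : -(d : ℤ) ^ 2 + 3 * (d : ℤ) - 3 = -(((d - 1) ^ 2 - (d - 2) : ℕ) : ℤ) := by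
    obtain ⟨m, rfl⟩ : ∃ m, d = m + 2 := ⟨d - 2, by omega⟩
    have hle : m ≤ (m + 1) ^ 2 := by nlinarith
    rw [show m + 2 - 1 = m + 1 by omega, show m + 2 - 2 = m by omega, Nat.cast_sub hle]
    push_cast
    ring
  rw [hpolar, hformula f hf, hexp, zpow_neg, zpow_natCast, ← mul_assoc, neg_mul_neg,
    inv_mul_cancel₀ (pow_ne_zero _ hd0), one_mul]
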